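/- All graphs are finite, simple and connected. Let $G=G(A,B)$ be a cubic bipartite graph with colour classes $A$ and $B$. A pair $a\in A$, $b\in B$ is *nice* if $G-(N_G[a]\cup N_G[b])$ has a perfect matching, where $N_G[v]$ is the set consisting of $v$ and its neighbours (the graph without vertices has a perfect matching). A pair $(A',B')$ with $A'\subseteq A$ and $B'\subseteq B$ is a *nice pair set* if every pair $a\in A'$, $b\in B'$ is nice. For vertex-disjoint graphs $G_1,G_2$ with edges $e_1=x_1x_2\in E(G_1)$ and $e_2=y_1y_2\in E(G_2)$, the *edge splicing* $(G_1\oplus G_2)_{e_1,e_2}$ is obtained from the union of $G_1-e_1$ and $G_2-e_2$ by identifying $x_i$ with $y_i$ for $i=1,2$ (either labelling of the ends of each edge is allowed). For $n\ge 1$ let $L_n$ be the linear quadrangular chain with $n$ quadrangles, that is, the ladder $P_{n+1}\,\square\,P_2$, where $P_k$ is the path on $k$ vertices. A *22-edge* is an edge both of whose ends have degree $2$. Let $\mathcal T$ be the smallest class of graphs, closed under isomorphism, such that 1. $K_{3,3}\in\mathcal T$; 2. if $T\in\mathcal T$, $f\in E(T)$, $n\ge 1$, $e_1,e_2$ are two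 22-edges of $L_n$ without a common end, and $g\in E(K_{3,3})$, then $\bigl(T\oplus (L_n\oplus K_{3,3})_{e_1,g}\bigr)_{f,e_2}\in\mathcal T$. **Theorem.** Let $G(A,B)$ be a (connected) cubic bipartite graph. Then $G$ has a nice pair set $(A',B')$ with $|A'|\ge 3$ and $|B'|\ge 3$. Moreover, every nice pair set $(A',B')$ of $G$ with $A'\neq\emptyset$ and $B'\neq\emptyset$ satisfies $|A'|\le 3$ and $|B'|\le 3$ if and only if $G\in\mathcal T$. -/

import Mathlib

universe u v

namespace SimpleGraph

section NicePairs

variable {V : Type u}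

/-- The closed neighbourhood `N[v]` of a vertex. -/
def closedNeighborSet (G : SimpleGraph V) (v : V) : Set V :=
  insert v (G.neighborSet v)

/-- A subgraph `H` of `G` is nice if `G - V(H)` has a perfect matching. -/
def Subgraph.IsNice {G : SimpleGraph V} (H : G.Subgraph) : Prop :=
  ∃ M : (G.induce H.vertsᶜ).Subgraph, M.IsPerfectMatching

/-- The vertices `a` and `b` together with their neighbours induce a nice subgraph of `G`.
This is meant for `a` and `b` in different colour classes of a bipartite graph. -/
def IsNicePair (G : SimpleGraph V) (a b : V) : Prop :=
  ((⊤ : G.Subgraph).induce (G.closedNeighborSet a ∪ G.closedNeighborSet b)).IsNice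

/-- `(A', B')` is a nice pair set of the bipartite graph `G` with colour classes `A` and `B`. -/
def IsNicePairSet (G : SimpleGraph V) (A B A' B' : Finset V) : Prop :=
  A' ⊆ A ∧ B' ⊆ B ∧ ∀ a ∈ A', ∀ b ∈ B', G.IsNicePair a b

end NicePairs

section EdgeSplicing

variable {V : Type u} {W : Type v}

open Classical in
/-- The map of the vertices of the second graph into the vertex set of the edge splicing:
`y₁` and `y₂` are identified with `x₁` and `x₂`, all other vertices are kept as new ones. -/
noncomputable def edgeSpliceMap (x₁ x₂ : V) (y₁ y₂ : W) (w : W) :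
    V ⊕ {w : W // w ≠ y₁ ∧ w ≠ y₂} :=
  if h₁ : w = y₁ then Sum.inl x₁
  else if h₂ : w = y₂ then Sum.inl x₂
  else Sum.inr ⟨w, h₁, h₂⟩

/-- The edge splicing of `G` at the edge `x₁x₂` and `H` at the edge `y₁y₂`: the union of
`G - x₁x₂` and `H - y₁y₂` with `xᵢ` and `yᵢ` identified for `i = 1, 2`. -/
noncomputable def edgeSplice (G : SimpleGraph V) (x₁ x₂ : V) (H : SimpleGraph W) (y₁ y₂ : W) :
    SimpleGraph (V ⊕ {w : W // w ≠ y₁ ∧ w ≠ y₂}) :=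
  (G.deleteEdges {s(x₁, x₂)}).map Sum.inl ⊔
    (H.deleteEdges {s(y₁, y₂)}).map (edgeSpliceMap x₁ x₂ y₁ y₂)

/-- `xy` is a 22-edge: an edge both of whose ends have degree 2. -/
def Is22Edge (G : SimpleGraph V) (x y : V) : Prop :=
  G.Adj x y ∧ (G.neighborSet x).ncard = 2 ∧ (G.neighborSet y).ncard = 2

end EdgeSplicing

/-- The linear quadrangular chain with `n` quadrangles, that is, the ladder with `n + 1` rungs. -/
def quadChain (n : ℕ) : SimpleGraph (Fin (n + 1) × Fin 2) :=
  pathGraph (n + 1) □ pathGraph 2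

/-- The complete bipartite graph with both sides of size 3. -/
def K33 : SimpleGraph (Fin 3 ⊕ Fin 3) :=
  completeBipartiteGraph (Fin 3) (Fin 3)

/-- The family `T`, up to isomorphism: it contains `K33`, and with `T` also the edge splicing
of `T` at any edge `f = t₁t₂` and (the edge splicing of the quadrangular chain with `n ≥ 1`
quadrangles at `e₁ = p₁p₂` and `K33` at any edge) at `e₂ = q₁q₂`, where `e₁` and `e₂` are two
22-edges of the chain without a common end (for `n ≥ 2` any two distinct 22-edges of the chain are
such; for `n = 1` the chain is a 4-cycle, and disjointness makes the resulting graph cubic). -/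
inductive InFamilyT : {V : Type u} → SimpleGraph V → Prop
  | base {V : Type u} (G : SimpleGraph V) (h : Nonempty (G ≃g K33)) : InFamilyT G
  | step {U V : Type u} (T : SimpleGraph U) (G : SimpleGraph V) (hT : InFamilyT T)
      (t₁ t₂ : U) (ht : T.Adj t₁ t₂)
      (n : ℕ) (hn : 1 ≤ n) (p₁ p₂ q₁ q₂ : Fin (n + 1) × Fin 2)
      (hp : (quadChain n).Is22Edge p₁ p₂) (hq : (quadChain n).Is22Edge q₁ q₂)
      (hpq : Disjoint ({p₁, p₂} : Set (Fin (n + 1) × Fin 2)) {q₁, q₂})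
      (w₁ w₂ : Fin 3 ⊕ Fin 3) (hw : K33.Adj w₁ w₂)
      (h : Nonempty (G ≃g T.edgeSplice t₁ t₂
        ((quadChain n).edgeSplice p₁ p₂ K33 w₁ w₂) (Sum.inl q₁) (Sum.inl q₂))) :
      InFamilyT G

end SimpleGraph

/-! By Hall's theorem, `a ∈ A` and `b ∈ B` form a nice pair iff every `S ⊆ A` that contains `a`, and
in which only `a` may be adjacent to `b`, has at least `#S + 2` neighbours (`isNicePair_iff`).
Connectedness and 3-regularity already give `#S + 1` neighbours for every nonempty proper `S`, so
the obstructions are sets that miss the bound only just.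

Suppose first that there is no 2-edge cut. Then a pair that is not nice is separated by a tight set
(`exists_isTight`). Without tight sets all pairs are nice. Otherwise take a smallest tight set `S`,
in either colour: uncrossing shows that all pairs from `S` and `N(S)` are nice, which gives sizes at
least 3 and 4 if `#S ≥ 3`. If `#S = 2`, then `S` and `N(S)` span a `K_{2,3}`, and `S` can be
replaced by `N(N(S))`. Hence sizes 3 and 3 always occur, and a colour class of size at least 4
forces a side of size at least 4 (`exists_isNicePairSet_of_noTwoCut`). So `K33` is the only bounded
graph without 2-edge cuts.

A 2-edge cut is never crossed by a nice pair (`IsTwoCut.mem_iff_of_isNicePair`), and pairs inside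
one side are nice in the graph iff they are nice in the torso of that side
(`IsTorso.isNicePair_map`, `IsTorso.isNicePair_of_map`). The torso of a smallest side has no 2-edge
cut, so the first statement reduces to the previous case.

For the characterization, a splicing of `T`, a chain and `K33` is sliced by 2-edge cuts into levels:
`T`, the inner rungs, and the six vertices of `K33`. A nice pair set with nonempty sides lies in one
level, so it is bounded if `T` is (`niceBounded_chainSplice`). Conversely, in a bounded graph with a
2-edge cut the torso of a smallest side is `K33`. Starting there, follow the ladder of consecutive
2-edge cuts as long as the next two ends are adjacent (`IsChainEnd.exists_maximal`). The torso of
what remains is smaller and bounded, and induction applies (`IsCubicBip.inFamilyT`). -/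

namespace SimpleGraph

open Finset

/-- `G` is a connected cubic bipartite graph with colour classes `A` and `B`. -/
structure IsCubicBip {V : Type*} (G : SimpleGraph V) (A B : Finset V) : Prop where
  conn : G.Connected
  deg : ∀ v, (G.neighborSet v).ncard = 3
  disj : Disjoint A B
  adj : ∀ ⦃v w⦄, G.Adj v w → (v ∈ A ∧ w ∈ B) ∨ (v ∈ B ∧ w ∈ A)

/-- The set of neighbours of the vertices in `S`. -/
noncomputable def nbhd {V : Type*} [Fintype V] (G : SimpleGraph V) (S : Finset V) : Finset V :=
  open Classical in univ.filter fun v => ∃ s ∈ S, G.Adj s v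

/-- The number of pairs in `S × T` which are edges of `G`. -/
noncomputable def edgeCount {V : Type*} (G : SimpleGraph V) (S T : Finset V) : ℕ :=
  open Classical in #((S ×ˢ T).filter fun p => G.Adj p.1 p.2)

/-! ### Edge counts and neighbourhoods in cubic bipartite graphs -/

section
variable {V : Type*} {G : SimpleGraph V}

theorem edgeCount_comm (S T : Finset V) : G.edgeCount S T = G.edgeCount T S := by
  classical
  unfold edgeCount
  refine card_bij (fun p _ => p.swap) ?_ ?_ ?_
  · rintro ⟨x, y⟩ h
    simp only [mem_filter, mem_product, Prod.swap] at h ⊢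
    exact ⟨⟨h.1.2, h.1.1⟩, h.2.symm⟩
  · rintro p _ q _ h
    exact Prod.swap_injective h
  · rintro ⟨x, y⟩ h
    refine ⟨(y, x), ?_, rfl⟩
    simp only [mem_filter, mem_product] at h ⊢
    exact ⟨⟨h.1.2, h.1.1⟩, h.2.symm⟩

theorem edgeCount_eq_sum [DecidableRel G.Adj] (S T : Finset V) :
    G.edgeCount S T = ∑ x ∈ S, #(T.filter fun y => G.Adj x y) := by
  classical
  unfold edgeCount
  rw [card_filter, sum_product]
  refine sum_congr rfl fun x _ => ?_
  rw [card_filter]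
  refine sum_congr rfl fun y _ => ?_
  congr

theorem edgeCount_add_sdiff [DecidableEq V] {S T T' : Finset V} (h : T' ⊆ T) :
    G.edgeCount S T = G.edgeCount S T' + G.edgeCount S (T \ T') := by
  classical
  simp only [edgeCount_eq_sum, ← sum_add_distrib]
  refine sum_congr rfl fun x _ => ?_
  rw [← card_union_of_disjoint, ← filter_union, union_sdiff_of_subset h]
  exact disjoint_filter_filter disjoint_sdiff

theorem edgeCount_eq_zero {S T : Finset V} :
    G.edgeCount S T = 0 ↔ ∀ x ∈ S, ∀ y ∈ T, ¬ G.Adj x y := by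
  classical
  unfold edgeCount
  rw [card_eq_zero, filter_eq_empty_iff]
  constructor
  · intro h x hx y hy
    exact h (x := (x, y)) (mem_product.2 ⟨hx, hy⟩)
  · rintro h ⟨x, y⟩ hp
    exact h x (mem_product.1 hp).1 y (mem_product.1 hp).2

theorem edgeCount_mono {S S' T T' : Finset V} (hS : S ⊆ S') (hT : T ⊆ T') :
    G.edgeCount S T ≤ G.edgeCount S' T' := by
  classical
  unfold edgeCount
  exact card_le_card (filter_subset_filter _ (product_subset_product hS hT))

theorem mem_nbhd [Fintype V] {S : Finset V} {v : V} : v ∈ G.nbhd S ↔ ∃ s ∈ S, G.Adj s v := by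
  simp [nbhd]

theorem nbhd_mono [Fintype V] {S T : Finset V} (h : S ⊆ T) : G.nbhd S ⊆ G.nbhd T := by
  intro v hv
  obtain ⟨s, hs, ha⟩ := mem_nbhd.1 hv
  exact mem_nbhd.2 ⟨s, h hs, ha⟩

theorem nbhd_union [Fintype V] [DecidableEq V] {S T : Finset V} :
    G.nbhd (S ∪ T) = G.nbhd S ∪ G.nbhd T := by
  ext v
  simp only [mem_nbhd, mem_union, or_and_right, exists_or]

theorem Connected.eq_univ_of_closed (hG : G.Connected) {W : Set V} (hne : W.Nonempty)
    (h : ∀ x ∈ W, ∀ y, G.Adj x y → y ∈ W) : W = Set.univ := by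
  obtain ⟨x, hx⟩ := hne
  refine Set.eq_univ_of_forall fun y => ?_
  obtain ⟨p⟩ := hG.preconnected x y
  induction p with
  | nil => exact hx
  | cons hadj _ ih => exact ih (h _ hx _ hadj)

namespace IsCubicBip
variable {A B : Finset V}

theorem symm (h : G.IsCubicBip A B) : G.IsCubicBip B A :=
  ⟨h.conn, h.deg, h.disj.symm, fun _ _ hvw => (h.adj hvw).symm⟩

theorem notMem_right (h : G.IsCubicBip A B) {v : V} (hv : v ∈ A) : v ∉ B :=
  Finset.disjoint_left.1 h.disj hv

theorem notMem_left (h : G.IsCubicBip A B) {v : V} (hv : v ∈ B) : v ∉ A :=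
  Finset.disjoint_right.1 h.disj hv

theorem mem_right (h : G.IsCubicBip A B) {v w : V} (hvw : G.Adj v w) (hv : v ∈ A) : w ∈ B := by
  rcases h.adj hvw with h1 | h1
  · exact h1.2
  · exact absurd h1.1 (h.notMem_right hv)

theorem mem_left (h : G.IsCubicBip A B) {v w : V} (hvw : G.Adj v w) (hv : v ∈ B) : w ∈ A :=
  h.symm.mem_right hvw hv

theorem exists_neighbors (h : G.IsCubicBip A B) (v : V) :
    ∃ x y z, x ≠ y ∧ x ≠ z ∧ y ≠ z ∧ ∀ w, G.Adj v w ↔ w = x ∨ w = y ∨ w = z := by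
  obtain ⟨x, y, z, hxy, hxz, hyz, he⟩ := Set.ncard_eq_three.1 (h.deg v)
  refine ⟨x, y, z, hxy, hxz, hyz, fun w => ?_⟩
  have : w ∈ G.neighborSet v ↔ w ∈ ({x, y, z} : Set V) := by rw [he]
  simpa using this

theorem mem_or_mem (h : G.IsCubicBip A B) (v : V) : v ∈ A ∨ v ∈ B := by
  obtain ⟨x, y, z, -, -, -, he⟩ := h.exists_neighbors v
  rcases h.adj ((he x).2 (Or.inl rfl)) with h1 | h1
  · exact Or.inl h1.1
  · exact Or.inr h1.1

theorem card_neighbors [Fintype V] (h : G.IsCubicBip A B) (v : V) : #(G.nbhd {v}) = 3 := by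
  rw [← h.deg v, ← Set.ncard_coe_finset]
  congr 1
  ext w
  simp [mem_nbhd]

theorem card_filter_adj [Fintype V] [DecidableRel G.Adj] (h : G.IsCubicBip A B) {v : V}
    (hv : v ∈ A) : #(B.filter fun w => G.Adj v w) = 3 := by
  rw [← h.card_neighbors v]
  congr 1
  ext w
  simp only [mem_filter, mem_nbhd, mem_singleton, exists_eq_left, and_iff_right_iff_imp]
  exact fun hw => h.mem_right hw hv

theorem edgeCount_right [Fintype V] (h : G.IsCubicBip A B) {S : Finset V} (hS : S ⊆ A) :
    G.edgeCount S B = 3 * #S := by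
  classical
  rw [edgeCount_eq_sum, sum_congr rfl fun x hx => h.card_filter_adj (hS hx)]
  simp [mul_comm]

theorem card_eq [Fintype V] (h : G.IsCubicBip A B) : #A = #B := by
  have h1 := h.edgeCount_right (subset_refl A)
  have h2 := h.symm.edgeCount_right (subset_refl B)
  rw [edgeCount_comm] at h2
  omega

theorem nbhd_subset [Fintype V] (h : G.IsCubicBip A B) {S : Finset V} (hS : S ⊆ A) :
    G.nbhd S ⊆ B := by
  intro v hv
  obtain ⟨s, hs, ha⟩ := mem_nbhd.1 hv
  exact h.mem_right ha (hS hs)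

theorem edgeCount_nbhd [Fintype V] (h : G.IsCubicBip A B) {S : Finset V} (hS : S ⊆ A) :
    G.edgeCount S (G.nbhd S) = 3 * #S := by
  classical
  have h1 := edgeCount_add_sdiff (G := G) (S := S) (h.nbhd_subset hS)
  have h2 : G.edgeCount S (B \ G.nbhd S) = 0 := by
    refine edgeCount_eq_zero.2 fun x hx y hy hxy => ?_
    exact (mem_sdiff.1 hy).2 (mem_nbhd.2 ⟨x, hx, hxy⟩)
  rw [h.edgeCount_right hS] at h1
  omega

/-- If `N(S)` had at most `#S` vertices, the `3 * #S` edges at `S` would exhaust the degrees in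
`N(S)`. Then `S ∪ N(S)` is closed under adjacency, hence everything by connectedness. -/
theorem card_add_one_le_nbhd [Fintype V] (h : G.IsCubicBip A B) {S : Finset V} (hS : S ⊆ A)
    (hne : S.Nonempty) (hA : S ≠ A) : #S + 1 ≤ #(G.nbhd S) := by
  classical
  by_contra! hlt
  have h1 := h.edgeCount_nbhd hS
  have h2 := h.symm.edgeCount_right (h.nbhd_subset hS)
  rw [edgeCount_add_sdiff hS, edgeCount_comm] at h2
  have h3 : G.edgeCount (G.nbhd S) (A \ S) = 0 := by omega
  rw [edgeCount_eq_zero] at h3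
  have h4 : ((S ∪ G.nbhd S : Finset V) : Set V) = Set.univ := by
    refine h.conn.eq_univ_of_closed (by obtain ⟨x, hx⟩ := hne; exact ⟨x, by simp [hx]⟩) ?_
    intro x hx y hxy
    simp only [coe_union, Set.mem_union, mem_coe] at hx ⊢
    rcases hx with hx | hx
    · exact Or.inr (mem_nbhd.2 ⟨x, hx, hxy⟩)
    · by_contra hcon
      push Not at hcon
      exact h3 x hx y (mem_sdiff.2 ⟨h.mem_left hxy (h.nbhd_subset hS hx), hcon.1⟩) hxy
  apply hA
  refine Finset.Subset.antisymm hS fun x hx => ?_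
  have : x ∈ ((S ∪ G.nbhd S : Finset V) : Set V) := by rw [h4]; trivial
  simp only [coe_union, Set.mem_union, mem_coe] at this
  rcases this with h5 | h5
  · exact h5
  · exact absurd (h.nbhd_subset hS h5) (h.notMem_right hx)

theorem card_le_nbhd [Fintype V] (h : G.IsCubicBip A B) {S : Finset V} (hS : S ⊆ A) :
    #S ≤ #(G.nbhd S) := by
  have h1 := h.edgeCount_nbhd hS
  have h2 := h.symm.edgeCount_right (h.nbhd_subset hS)
  have h3 := edgeCount_mono (G := G) (subset_refl (G.nbhd S)) hS
  rw [edgeCount_comm] at h3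
  omega

end IsCubicBip
end

/-! ### Hall's criterion for nice pairs -/

section
variable {V : Type*} {G : SimpleGraph V} {A B : Finset V} [Fintype V]

theorem isNicePair_comm {V : Type*} {G : SimpleGraph V} {a b : V} :
    G.IsNicePair a b ↔ G.IsNicePair b a := by
  unfold IsNicePair
  rw [Set.union_comm]

namespace IsCubicBip

/-- The perfect matching sends `S \ {a}` injectively into `N(S)` and avoids the three neighbours of
`a`, so `N(S)` has at least `3 + (#S - 1)` vertices. -/
theorem le_nbhd_of_isNicePair (h : G.IsCubicBip A B) {a b : V} (ha : a ∈ A) (hb : b ∈ B)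
    (hn : G.IsNicePair a b) {S : Finset V} (hS : S ⊆ A) (haS : a ∈ S)
    (hbS : ∀ s ∈ S, G.Adj s b → s = a) : #S + 2 ≤ #(G.nbhd S) := by
  classical
  obtain ⟨M, hM⟩ := hn
  rw [Subgraph.isPerfectMatching_iff] at hM
  have hout : ∀ s ∈ S.erase a, s ∉ G.closedNeighborSet a ∪ G.closedNeighborSet b := by
    intro s hs
    obtain ⟨hsa, hsS⟩ := mem_erase.1 hs
    simp only [closedNeighborSet, Set.mem_union, Set.mem_insert_iff, mem_neighborSet]
    rintro ((h1 | h1) | (h1 | h1))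
    · exact hsa h1
    · exact h.notMem_right (hS hsS) (h.mem_right h1 ha)
    · exact h.notMem_right (hS hsS) (h1 ▸ hb)
    · exact hsa (hbS s hsS h1.symm)
  have hf : ∀ s : S.erase a, ∃ w : V, ∃ hw, M.Adj ⟨s, hout s s.2⟩ ⟨w, hw⟩ := by
    intro s
    obtain ⟨w, hw, -⟩ := hM ⟨s, hout s s.2⟩
    exact ⟨w.1, w.2, hw⟩
  choose f hfm hf using hf
  have hinj : Function.Injective f := by
    intro s s' hss
    obtain ⟨w, -, hw⟩ := hM ⟨f s, hfm s⟩
    have h1 := hw _ (hf s).symm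
    have h2 : M.Adj ⟨f s, hfm s⟩ ⟨s', hout s' s'.2⟩ := by
      have := (hf s').symm
      simpa only [← hss] using this
    have h3 := hw _ h2
    have := h1.trans h3.symm
    exact Subtype.ext (Subtype.mk.inj this)
  have hsub : G.nbhd {a} ∪ univ.image f ⊆ G.nbhd S := by
    refine union_subset (nbhd_mono (singleton_subset_iff.2 haS)) fun w hw => ?_
    obtain ⟨s, -, rfl⟩ := mem_image.1 hw
    exact mem_nbhd.2 ⟨s, mem_of_mem_erase s.2, (hf s).adj_sub⟩
  have hdis : Disjoint (G.nbhd {a}) (univ.image f) := by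
    rw [Finset.disjoint_right]
    intro w hw hwa
    obtain ⟨s, -, rfl⟩ := mem_image.1 hw
    obtain ⟨a', ha', hadj⟩ := mem_nbhd.1 hwa
    rw [mem_singleton] at ha'
    subst ha'
    exact hfm s (Or.inl (Or.inr hadj))
  have hc := card_le_card hsub
  rw [card_union_of_disjoint hdis, h.card_neighbors, card_image_of_injective _ hinj,
    Finset.card_univ, Fintype.card_coe, card_erase_of_mem haS] at hc
  have := card_pos.2 ⟨a, haS⟩
  omega

theorem isNicePair_of_forall (h : G.IsCubicBip A B) {a b : V} (ha : a ∈ A) (hb : b ∈ B)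
    (hH : ∀ S ⊆ A, a ∈ S → (∀ s ∈ S, G.Adj s b → s = a) → #S + 2 ≤ #(G.nbhd S)) :
    G.IsNicePair a b := by
  classical
  set C : Set V := G.closedNeighborSet a ∪ G.closedNeighborSet b with hC
  set A₀ := A.filter (· ∉ C)
  set B₀ := B.filter (· ∉ C)
  have hall : ∃ f : A₀ → V, Function.Injective f ∧
      ∀ x, f x ∈ (G.nbhd {x.1}).filter (· ∉ C) := by
    rw [← Finset.all_card_le_biUnion_card_iff_exists_injective]
    intro s
    have hs : ∀ x ∈ s.image Subtype.val, x ∈ A ∧ x ∉ C := by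
      intro x hx
      obtain ⟨y, -, rfl⟩ := mem_image.1 hx
      exact mem_filter.1 y.2
    have haC : a ∈ C := Or.inl (Or.inl rfl)
    have hnot : a ∉ s.image Subtype.val := fun h1 => (hs a h1).2 haC
    -- Adding `a` to a Hall set costs one vertex and the surplus 2 in the hypothesis, which together
    -- pay for the three neighbours of `a`.
    have h1 := hH (insert a (s.image Subtype.val)) (insert_subset ha fun x hx => (hs x hx).1)
      (mem_insert_self _ _) (by
        intro x hx hxb
        rcases mem_insert.1 hx with h1 | h1
        · exact h1
        · exact absurd (Or.inr (Or.inr hxb.symm)) (hs x h1).2)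
    rw [card_insert_of_notMem hnot, card_image_of_injective _ Subtype.val_injective] at h1
    have h2 : G.nbhd (insert a (s.image Subtype.val)) ⊆
        G.nbhd {a} ∪ s.biUnion fun x => (G.nbhd {x.1}).filter (· ∉ C) := by
      intro w hw
      by_cases hwa : G.Adj a w
      · exact mem_union_left _ (mem_nbhd.2 ⟨a, mem_singleton_self a, hwa⟩)
      refine mem_union_right _ ?_
      obtain ⟨x, hx, hxw⟩ := mem_nbhd.1 hw
      rcases mem_insert.1 hx with h1 | h1
      · exact absurd (h1 ▸ hxw) hwa
      have hxC := hs x h1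
      obtain ⟨y, hy, rfl⟩ := mem_image.1 h1
      refine mem_biUnion.2 ⟨y, hy, mem_filter.2 ⟨mem_nbhd.2 ⟨_, mem_singleton_self _, hxw⟩, ?_⟩⟩
      have hwB := h.mem_right hxw hxC.1
      rintro ((h3 | h3) | (h3 | h3))
      · exact h.notMem_right ha (h3 ▸ hwB)
      · exact hwa h3
      · exact hxC.2 (Or.inr (Or.inr (h3 ▸ hxw.symm)))
      · exact h.notMem_right (h.mem_left h3 hb) hwB
    have h3 := (card_le_card h2).trans (card_union_le _ _)
    rw [h.card_neighbors] at h3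
    omega
  obtain ⟨f, hinj, hf⟩ := hall
  have hf' : ∀ x : A₀, G.Adj x.1 (f x) ∧ f x ∉ C := by
    intro x
    obtain ⟨h1, h2⟩ := mem_filter.1 (hf x)
    obtain ⟨y, hy, hyx⟩ := mem_nbhd.1 h1
    rw [mem_singleton] at hy
    exact ⟨hy ▸ hyx, h2⟩
  have hcA : A.filter (· ∈ C) = insert a (G.nbhd {b}) := by
    ext x
    simp only [mem_filter, mem_insert, mem_nbhd, mem_singleton, exists_eq_left, hC,
      closedNeighborSet, Set.mem_union, Set.mem_insert_iff, mem_neighborSet]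
    constructor
    · rintro ⟨hx, (h1 | h1) | (h1 | h1)⟩
      · exact Or.inl h1
      · exact absurd (h.mem_right h1 ha) (h.notMem_right hx)
      · exact absurd (h1 ▸ hb) (h.notMem_right hx)
      · exact Or.inr h1
    · rintro (h1 | h1)
      · exact ⟨h1 ▸ ha, Or.inl (Or.inl h1)⟩
      · exact ⟨h.mem_left h1 hb, Or.inr (Or.inr h1)⟩
  have hcB : B.filter (· ∈ C) = insert b (G.nbhd {a}) := by
    ext x
    simp only [mem_filter, mem_insert, mem_nbhd, mem_singleton, exists_eq_left, hC,
      closedNeighborSet, Set.mem_union, Set.mem_insert_iff, mem_neighborSet]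
    constructor
    · rintro ⟨hx, (h1 | h1) | (h1 | h1)⟩
      · exact absurd (h1 ▸ ha) (h.notMem_left hx)
      · exact Or.inr h1
      · exact Or.inl h1
      · exact absurd (h.mem_left h1 hb) (h.notMem_left hx)
    · rintro (h1 | h1)
      · exact ⟨h1 ▸ hb, Or.inr (Or.inl h1)⟩
      · exact ⟨h.mem_right h1 ha, Or.inl (Or.inr h1)⟩
  -- The removed parts `{a} ∪ N(b)` and `{b} ∪ N(a)` have equal size whether or not `a` and `b` are
  -- adjacent. So the injection from Hall's theorem is onto `B₀`.
  have hcard : #A₀ = #B₀ := by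
    have h1 := card_filter_add_card_filter_not (s := A) (· ∈ C)
    have h2 := card_filter_add_card_filter_not (s := B) (· ∈ C)
    have h3 := h.card_eq
    have h4 : #(A.filter (· ∈ C)) = #(B.filter (· ∈ C)) := by
      rw [hcA, hcB, card_insert_eq_ite, card_insert_eq_ite, h.card_neighbors, h.card_neighbors]
      simp only [mem_nbhd, mem_singleton, exists_eq_left, G.adj_comm a b]
    change #A₀ = #B₀
    simp only [A₀, B₀]
    omega
  have himg : univ.image f = B₀ := by
    refine eq_of_subset_of_card_le ?_ ?_
    · intro w hw
      obtain ⟨x, -, rfl⟩ := mem_image.1 hw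
      exact mem_filter.2 ⟨h.mem_right (hf' x).1 (mem_filter.1 x.2).1, (hf' x).2⟩
    · rw [card_image_of_injective _ hinj, Finset.card_univ, Fintype.card_coe, hcard]
  let s : Set ↥(Cᶜ) := {x | x.1 ∈ A}
  let g : s → ↥(Cᶜ) := fun x =>
    ⟨f ⟨x.1.1, mem_filter.2 ⟨x.2, x.1.2⟩⟩, (hf' _).2⟩
  have hginj : Function.Injective g := by
    intro x y hxy
    have := hinj (congrArg Subtype.val hxy)
    exact Subtype.ext (Subtype.ext (congrArg (fun z : A₀ => z.1) this))
  have hgadj : ∀ x : s, (G.induce Cᶜ).Adj x.1 (g x) := fun x =>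
    (hf' ⟨x.1.1, mem_filter.2 ⟨x.2, x.1.2⟩⟩).1
  obtain ⟨M, hM1, hM2⟩ := Subgraph.IsMatching.exists_of_disjoint_sets_of_equiv
    (G := G.induce Cᶜ) (s := s) (t := Set.range g) (by
      rw [Set.disjoint_right]
      rintro _ ⟨x, rfl⟩ hx
      exact h.notMem_right hx (h.mem_right (hgadj x) x.2))
    (Equiv.ofInjective g hginj) hgadj
  refine ⟨M, hM2, fun v => ?_⟩
  rw [hM1]
  rcases h.mem_or_mem v.1 with hv | hv
  · exact Or.inl hv
  · right
    have h1 : v.1 ∈ univ.image f := by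
      rw [himg]
      exact mem_filter.2 ⟨hv, v.2⟩
    obtain ⟨x, -, hx⟩ := mem_image.1 h1
    exact ⟨⟨⟨x.1, (mem_filter.1 x.2).2⟩, (mem_filter.1 x.2).1⟩, Subtype.ext hx⟩

/-- A pair `a`, `b` of a cubic bipartite graph is not nice if and only if it is separated by
a set `S` of vertices in the class of `a` with at most `#S + 1` neighbours. -/
theorem isNicePair_iff (h : G.IsCubicBip A B) {a b : V} (ha : a ∈ A) (hb : b ∈ B) :
    G.IsNicePair a b ↔
      ∀ S ⊆ A, a ∈ S → (∀ s ∈ S, G.Adj s b → s = a) → #S + 2 ≤ #(G.nbhd S) :=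
  ⟨fun hn _ hS haS hbS => h.le_nbhd_of_isNicePair ha hb hn hS haS hbS,
    fun hH => h.isNicePair_of_forall ha hb hH⟩

end IsCubicBip
end

/-! ### Two-edge cuts -/

/-- `st` and `ur` are the only edges between `W` and its complement, where `s` and `u` are in `W`
and have different colours. -/
structure IsTwoCut {V : Type*} (G : SimpleGraph V) (A B : Finset V) (W : Set V) (s t u r : V) :
    Prop where
  mem_s : s ∈ W
  mem_t : t ∉ W
  mem_u : u ∈ W
  mem_r : r ∉ W
  s_mem : s ∈ A
  t_mem : t ∈ B
  u_mem : u ∈ B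
  r_mem : r ∈ A
  adj_st : G.Adj s t
  adj_ur : G.Adj u r
  cross : ∀ ⦃x⦄, x ∈ W → ∀ ⦃y⦄, y ∉ W → G.Adj x y → (x = s ∧ y = t) ∨ (x = u ∧ y = r)

section
variable {V : Type*} {G : SimpleGraph V} {A B : Finset V}

namespace IsTwoCut
variable {W : Set V} {s t u r : V}

theorem swap (h : G.IsTwoCut A B W s t u r) : G.IsTwoCut B A W u r s t :=
  ⟨h.mem_u, h.mem_r, h.mem_s, h.mem_t, h.u_mem, h.r_mem, h.s_mem, h.t_mem, h.adj_ur, h.adj_st,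
    fun _ hx _ hy hxy => (h.cross hx hy hxy).symm⟩

theorem compl (h : G.IsTwoCut A B W s t u r) : G.IsTwoCut A B Wᶜ r u t s :=
  ⟨h.mem_r, fun h' => h' h.mem_u, h.mem_t, fun h' => h' h.mem_s, h.r_mem, h.u_mem, h.t_mem,
    h.s_mem, h.adj_ur.symm, h.adj_st.symm, fun x hx y hy hxy => by
      rcases h.cross (not_not.1 hy) hx hxy.symm with h1 | h1
      · exact Or.inr ⟨h1.2, h1.1⟩
      · exact Or.inl ⟨h1.2, h1.1⟩⟩

theorem edgeCount_left [DecidableEq V] [DecidablePred (· ∈ W)] (hG : G.IsCubicBip A B)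
    (h : G.IsTwoCut A B W s t u r) :
    G.edgeCount (A.filter (· ∈ W)) (B \ B.filter (· ∈ W)) = 1 := by
  classical
  unfold edgeCount
  rw [card_eq_one]
  refine ⟨(s, t), ?_⟩
  ext ⟨x, y⟩
  simp only [mem_filter, mem_product, mem_sdiff, mem_singleton, Prod.mk.injEq, not_and]
  constructor
  · rintro ⟨⟨⟨hxA, hxW⟩, hyB, hyW⟩, hxy⟩
    rcases h.cross hxW (hyW hyB) hxy with h1 | h1
    · exact h1
    · exact absurd (h1.1 ▸ hxA) (hG.notMem_left h.u_mem)
  · rintro ⟨rfl, rfl⟩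
    exact ⟨⟨⟨h.s_mem, h.mem_s⟩, h.t_mem, fun _ => h.mem_t⟩, h.adj_st⟩

/-- Both `3 * #(A ∩ W)` and `3 * #(B ∩ W)` count the edges inside `W` plus exactly one cut edge. -/
theorem card_eq [Fintype V] [DecidablePred (· ∈ W)] (hG : G.IsCubicBip A B)
    (h : G.IsTwoCut A B W s t u r) :
    #(A.filter (· ∈ W)) = #(B.filter (· ∈ W)) := by
  classical
  have h1 := h.edgeCount_left hG
  have h2 := h.swap.edgeCount_left hG.symm
  have h3 := hG.edgeCount_right (filter_subset (· ∈ W) A)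
  have h4 := hG.symm.edgeCount_right (filter_subset (· ∈ W) B)
  rw [edgeCount_add_sdiff (filter_subset (· ∈ W) B)] at h3
  rw [edgeCount_add_sdiff (filter_subset (· ∈ W) A), edgeCount_comm] at h4
  omega

/-- By balance, `A ∩ W` has at most one neighbour more than it has vertices, namely `t` in addition
to `B ∩ W`. This violates Hall's criterion. -/
theorem not_isNicePair [Fintype V] (hG : G.IsCubicBip A B)
    (h : G.IsTwoCut A B W s t u r) {a b : V} (ha : a ∈ A) (hb : b ∈ B) (haW : a ∈ W)
    (hbW : b ∉ W) : ¬ G.IsNicePair a b := by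
  classical
  rw [hG.isNicePair_iff ha hb]
  push Not
  have hc := h.card_eq hG
  -- Only in this case is `A ∩ W` not admissible in the criterion, as `s` is adjacent to `b`.
  -- Dropping `s` also loses the neighbour `t`, so the deficiency is kept.
  by_cases hbt : b = t ∧ a ≠ s
  · refine ⟨(A.filter (· ∈ W)).erase s, (erase_subset _ _).trans (filter_subset _ _), ?_, ?_, ?_⟩
    · exact mem_erase.2 ⟨hbt.2, mem_filter.2 ⟨ha, haW⟩⟩
    · intro x hx hxb
      obtain ⟨hxs, hx⟩ := mem_erase.1 hx
      rcases h.cross (mem_filter.1 hx).2 hbW hxb with h1 | h1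
      · exact absurd h1.1 hxs
      · exact absurd (h1.1 ▸ (mem_filter.1 hx).1) (hG.notMem_left h.u_mem)
    · have h1 : G.nbhd ((A.filter (· ∈ W)).erase s) ⊆ B.filter (· ∈ W) := by
        intro y hy
        obtain ⟨x, hx, hxy⟩ := mem_nbhd.1 hy
        obtain ⟨hxs, hx⟩ := mem_erase.1 hx
        obtain ⟨hxA, hxW⟩ := mem_filter.1 hx
        refine mem_filter.2 ⟨hG.mem_right hxy hxA, ?_⟩
        by_contra hyW
        rcases h.cross hxW hyW hxy with h1 | h1
        · exact hxs h1.1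
        · exact absurd (h1.1 ▸ hxA) (hG.notMem_left h.u_mem)
      have h2 := card_le_card h1
      have h3 : s ∈ A.filter (· ∈ W) := mem_filter.2 ⟨h.s_mem, h.mem_s⟩
      have := card_pos.2 ⟨s, h3⟩
      rw [card_erase_of_mem h3]
      omega
  · refine ⟨A.filter (· ∈ W), filter_subset _ _, mem_filter.2 ⟨ha, haW⟩, ?_, ?_⟩
    · intro x hx hxb
      rcases h.cross (mem_filter.1 hx).2 hbW hxb with h1 | h1
      · push Not at hbt
        rw [h1.1, hbt h1.2]
      · exact absurd (h1.1 ▸ (mem_filter.1 hx).1) (hG.notMem_left h.u_mem)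
    · have h1 : G.nbhd (A.filter (· ∈ W)) ⊆ insert t (B.filter (· ∈ W)) := by
        intro y hy
        obtain ⟨x, hx, hxy⟩ := mem_nbhd.1 hy
        obtain ⟨hxA, hxW⟩ := mem_filter.1 hx
        rw [mem_insert, mem_filter]
        by_cases hyW : y ∈ W
        · exact Or.inr ⟨hG.mem_right hxy hxA, hyW⟩
        rcases h.cross hxW hyW hxy with h1 | h1
        · exact Or.inl h1.2
        · exact absurd (h1.1 ▸ hxA) (hG.notMem_left h.u_mem)
      have h2 := (card_le_card h1).trans (card_insert_le _ _)
      omega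

theorem mem_iff_of_isNicePair [Fintype V] (hG : G.IsCubicBip A B)
    (h : G.IsTwoCut A B W s t u r) {a b : V} (ha : a ∈ A) (hb : b ∈ B) (hn : G.IsNicePair a b) :
    a ∈ W ↔ b ∈ W := by
  constructor
  · intro haW
    by_contra hbW
    exact h.not_isNicePair hG ha hb haW hbW hn
  · intro hbW
    by_contra haW
    exact h.compl.not_isNicePair hG ha hb haW (fun h' => h' hbW) hn

end IsTwoCut

/-- At most two edges cross and, by connectedness, at least one does. Counting degrees modulo 3
shows that exactly one crossing edge starts in `A ∩ W` and exactly one in `B ∩ W`. -/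
theorem IsCubicBip.exists_isTwoCut [Fintype V] (hG : G.IsCubicBip A B) {W : Set V}
    (hne : W.Nonempty) (huniv : W ≠ Set.univ) {x₁ y₁ x₂ y₂ : V}
    (hcross : ∀ x ∈ W, ∀ y ∉ W, G.Adj x y → (x = x₁ ∧ y = y₁) ∨ (x = x₂ ∧ y = y₂)) :
    ∃ s t u r, G.IsTwoCut A B W s t u r := by
  classical
  have h3 := hG.edgeCount_right (filter_subset (· ∈ W) A)
  have h4 := hG.symm.edgeCount_right (filter_subset (· ∈ W) B)
  rw [edgeCount_add_sdiff (filter_subset (· ∈ W) B)] at h3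
  rw [edgeCount_add_sdiff (filter_subset (· ∈ W) A), edgeCount_comm] at h4
  set E₁ := ((A.filter (· ∈ W)) ×ˢ (B \ B.filter (· ∈ W))).filter fun p => G.Adj p.1 p.2
    with hE₁
  set E₂ := ((B.filter (· ∈ W)) ×ˢ (A \ A.filter (· ∈ W))).filter fun p => G.Adj p.1 p.2
    with hE₂
  have e1 : G.edgeCount (A.filter (· ∈ W)) (B \ B.filter (· ∈ W)) = #E₁ := by
    unfold edgeCount
    congr
  have e2 : G.edgeCount (B.filter (· ∈ W)) (A \ A.filter (· ∈ W)) = #E₂ := by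
    unfold edgeCount
    congr
  have m1 : ∀ p, p ∈ E₁ ↔ ((p.1 ∈ A ∧ p.1 ∈ W) ∧ p.2 ∈ B ∧ p.2 ∉ W) ∧ G.Adj p.1 p.2 := by
    intro p
    simp only [hE₁, mem_filter, mem_product, mem_sdiff, not_and]
    grind
  have m2 : ∀ p, p ∈ E₂ ↔ ((p.1 ∈ B ∧ p.1 ∈ W) ∧ p.2 ∈ A ∧ p.2 ∉ W) ∧ G.Adj p.1 p.2 := by
    intro p
    simp only [hE₂, mem_filter, mem_product, mem_sdiff, not_and]
    grind
  have hdis : Disjoint E₁ E₂ := by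
    rw [Finset.disjoint_left]
    intro p hp hp'
    exact hG.notMem_right ((m1 p).1 hp).1.1.1 ((m2 p).1 hp').1.1.1
  have hsub : E₁ ∪ E₂ ⊆ {(x₁, y₁), (x₂, y₂)} := by
    intro p hp
    have : p.1 ∈ W ∧ p.2 ∉ W ∧ G.Adj p.1 p.2 := by
      rcases mem_union.1 hp with h | h
      · exact ⟨((m1 p).1 h).1.1.2, ((m1 p).1 h).1.2.2, ((m1 p).1 h).2⟩
      · exact ⟨((m2 p).1 h).1.1.2, ((m2 p).1 h).1.2.2, ((m2 p).1 h).2⟩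
    simp only [mem_insert, mem_singleton, Prod.ext_iff]
    exact hcross _ this.1 _ this.2.1 this.2.2
  have hle := (card_le_card hsub).trans card_le_two
  rw [card_union_of_disjoint hdis] at hle
  have hpos : 0 < #E₁ + #E₂ := by
    by_contra h0
    have h01 : #E₁ = 0 := by omega
    have h02 : #E₂ = 0 := by omega
    rw [card_eq_zero] at h01 h02
    apply huniv
    refine hG.conn.eq_univ_of_closed hne fun x hx y hxy => ?_
    by_contra hy
    rcases hG.adj hxy with h | h
    · have := (m1 (x, y)).2 ⟨⟨⟨h.1, hx⟩, h.2, hy⟩, hxy⟩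
      rw [h01] at this
      exact notMem_empty _ this
    · have := (m2 (x, y)).2 ⟨⟨⟨h.1, hx⟩, h.2, hy⟩, hxy⟩
      rw [h02] at this
      exact notMem_empty _ this
  -- By `h3` and `h4` the two numbers are congruent modulo 3, and their sum is 1 or 2.
  have c1 : #E₁ = 1 := by
    have : #E₂ = 0 ∨ #E₂ = 1 ∨ #E₂ = 2 := by omega
    rcases this with h | h | h <;> omega
  have c2 : #E₂ = 1 := by omega
  obtain ⟨⟨s, t⟩, hst⟩ := card_eq_one.1 c1
  obtain ⟨⟨u, r⟩, hur⟩ := card_eq_one.1 c2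
  have k1 := (m1 (s, t)).1 (by rw [hst]; exact mem_singleton_self _)
  have k2 := (m2 (u, r)).1 (by rw [hur]; exact mem_singleton_self _)
  refine ⟨s, t, u, r, k1.1.1.2, k1.1.2.2, k2.1.1.2, k2.1.2.2, k1.1.1.1, k1.1.2.1, k2.1.1.1,
    k2.1.2.1, k1.2, k2.2, fun x hx y hy hxy => ?_⟩
  rcases hG.adj hxy with h | h
  · have := (m1 (x, y)).2 ⟨⟨⟨h.1, hx⟩, h.2, hy⟩, hxy⟩
    rw [hst, mem_singleton] at this
    exact Or.inl (Prod.ext_iff.1 this)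
  · have := (m2 (x, y)).2 ⟨⟨⟨h.1, hx⟩, h.2, hy⟩, hxy⟩
    rw [hur, mem_singleton] at this
    exact Or.inr (Prod.ext_iff.1 this)

end

/-! ### Torsos of 2-edge cuts and transfer of nice pairs -/

/-- `φ` embeds `T` into `G` in such a way that the image is one side of a 2-edge cut and `T` is
obtained from this side by adding the edge `t₁t₂` between the ends of the two cut edges. -/
structure IsTorso {U V : Type*} (T : SimpleGraph U) (G : SimpleGraph V) (A B : Finset V)
    (φ : U → V) (t₁ t₂ : U) (x y : V) : Prop where
  inj : Function.Injective φ
  adj : T.Adj t₁ t₂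
  cut : G.IsTwoCut A B (Set.range φ) (φ t₁) x (φ t₂) y
  adj_iff : ∀ u v, G.Adj (φ u) (φ v) ↔ T.Adj u v ∧ s(u, v) ≠ s(t₁, t₂)

namespace IsTorso

variable {U V : Type*} {T : SimpleGraph U} {G : SimpleGraph V} {A B : Finset V}
    {φ : U → V} {t₁ t₂ : U} {x y : V}

theorem swap (h : IsTorso T G A B φ t₁ t₂ x y) : IsTorso T G B A φ t₂ t₁ y x :=
  ⟨h.inj, h.adj.symm, h.cut.swap, fun u v => by rw [h.adj_iff, Sym2.eq_swap (a := t₁)]⟩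

theorem ncard_neighborSet_of_mem [Finite V] (hG : G.IsCubicBip A B)
    (h : IsTorso T G A B φ t₁ t₂ x y) {u : U} (hu : φ u ∈ A) :
    (T.neighborSet u).ncard = 3 := by
  have hfin : Finite U := Finite.of_injective φ h.inj
  rw [← hG.deg (φ u), ← Set.ncard_image_of_injective _ h.inj]
  have hne : ∀ v, u ≠ t₁ → s(u, v) ≠ s(t₁, t₂) := by
    intro v hut he
    rcases Sym2.eq_iff.1 he with h1 | h1
    · exact hut h1.1
    · exact hG.notMem_right hu (h1.1 ▸ h.cut.u_mem)
  by_cases hut : u = t₁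
  · subst hut
    have hx : x ∉ φ '' (T.neighborSet u \ {t₂}) := by
      rintro ⟨v, -, hv⟩
      exact h.cut.mem_t ⟨v, hv⟩
    have : G.neighborSet (φ u) = insert x (φ '' (T.neighborSet u \ {t₂})) := by
      ext z
      simp only [mem_neighborSet, Set.mem_insert_iff, Set.mem_image, Set.mem_sdiff,
        Set.mem_singleton_iff]
      constructor
      · intro hz
        by_cases hzr : z ∈ Set.range φ
        · obtain ⟨v, rfl⟩ := hzr
          refine Or.inr ⟨v, ⟨((h.adj_iff _ _).1 hz).1, ?_⟩, rfl⟩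
          rintro rfl
          exact ((h.adj_iff _ _).1 hz).2 rfl
        · rcases h.cut.cross h.cut.mem_s hzr hz with h1 | h1
          · exact Or.inl h1.2
          · exact absurd (h1.1 ▸ hu) (hG.notMem_left h.cut.u_mem)
      · rintro (rfl | ⟨v, ⟨hv, hvt⟩, rfl⟩)
        · exact h.cut.adj_st
        · refine (h.adj_iff _ _).2 ⟨hv, fun he => ?_⟩
          rcases Sym2.eq_iff.1 he with h1 | h1
          · exact hvt h1.2
          · exact h.adj.ne h1.1
    rw [this, Set.ncard_insert_of_notMem hx, Set.ncard_image_of_injective _ h.inj,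
      Set.ncard_image_of_injective _ h.inj, Set.ncard_sdiff_singleton_add_one (show t₂ ∈ T.neighborSet u from h.adj)]
  · congr 1
    ext z
    simp only [mem_neighborSet, Set.mem_image]
    constructor
    · rintro ⟨v, hv, rfl⟩
      exact (h.adj_iff _ _).2 ⟨hv, hne v hut⟩
    · intro hz
      have hzr : z ∈ Set.range φ := by
        by_contra hzr
        rcases h.cut.cross ⟨u, rfl⟩ hzr hz with h1 | h1
        · exact hut (h.inj h1.1)
        · exact absurd (h1.1 ▸ hu) (hG.notMem_left h.cut.u_mem)
      obtain ⟨v, rfl⟩ := hzr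
      exact ⟨v, ((h.adj_iff _ _).1 hz).1, rfl⟩

theorem connected (hG : G.IsCubicBip A B) (h : IsTorso T G A B φ t₁ t₂ x y) : T.Connected := by
  classical
  -- Retract `G` onto `T` by collapsing the other side to `t₁`. The cut edge at `φ t₂` becomes
  -- `t₁t₂`, and the one at `φ t₁` disappears.
  let ρ : V → U := fun z => if hz : z ∈ Set.range φ then hz.choose else t₁
  have hρ : ∀ u, ρ (φ u) = u := by
    intro u
    have hz : φ u ∈ Set.range φ := ⟨u, rfl⟩
    simp only [ρ, dif_pos hz]
    exact h.inj hz.choose_spec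
  have hρ' : ∀ z ∉ Set.range φ, ρ z = t₁ := fun z hz => dif_neg hz
  have key : ∀ z w, G.Adj z w → T.Reachable (ρ z) (ρ w) := by
    have out : ∀ z w, z ∈ Set.range φ → w ∉ Set.range φ → G.Adj z w →
        T.Reachable (ρ z) (ρ w) := by
      intro z w hz hw hzw
      rw [hρ' w hw]
      rcases h.cut.cross hz hw hzw with h1 | h1
      · rw [h1.1, hρ]
      · rw [h1.1, hρ]
        exact h.adj.symm.reachable
    intro z w hzw
    by_cases hz : z ∈ Set.range φ <;> by_cases hw : w ∈ Set.range φ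
    · obtain ⟨u, rfl⟩ := hz
      obtain ⟨v, rfl⟩ := hw
      rw [hρ, hρ]
      exact ((h.adj_iff _ _).1 hzw).1.reachable
    · exact out z w hz hw hzw
    · exact (out w z hw hz hzw.symm).symm
    · rw [hρ' z hz, hρ' w hw]
  have key' : ∀ z w, G.Reachable z w → T.Reachable (ρ z) (ρ w) := by
    rintro z w ⟨p⟩
    induction p with
    | nil => exact Reachable.refl _
    | cons hadj _ ih => exact (key _ _ hadj).trans ih
  have : Nonempty U := ⟨t₁⟩
  refine ⟨fun u v => ?_⟩
  have := key' (φ u) (φ v) (hG.conn.preconnected _ _)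
  rwa [hρ, hρ] at this

theorem isCubicBip [Finite V] (hG : G.IsCubicBip A B) (h : IsTorso T G A B φ t₁ t₂ x y) :
    T.IsCubicBip (A.preimage φ h.inj.injOn) (B.preimage φ h.inj.injOn) := by
  refine ⟨h.connected hG, fun u => ?_, ?_, fun u v huv => ?_⟩
  · rcases hG.mem_or_mem (φ u) with hu | hu
    · exact h.ncard_neighborSet_of_mem hG hu
    · exact h.swap.ncard_neighborSet_of_mem hG.symm hu
  · rw [Finset.disjoint_left]
    intro u hu hu'
    exact hG.notMem_right (mem_preimage.1 hu) (mem_preimage.1 hu')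
  · simp only [mem_preimage]
    by_cases he : s(u, v) = s(t₁, t₂)
    · rcases Sym2.eq_iff.1 he with ⟨rfl, rfl⟩ | ⟨rfl, rfl⟩
      · exact Or.inl ⟨h.cut.s_mem, h.cut.u_mem⟩
      · exact Or.inr ⟨h.cut.u_mem, h.cut.s_mem⟩
    · exact hG.adj ((h.adj_iff _ _).2 ⟨huv, he⟩)

variable [Fintype V]

/-- `Q` has at least `#Q + 1` neighbours if it is nonempty, and the only one that can lie on the
side of `T` is `φ t₂`, which is seen from `y` alone. -/
theorem card_le_outer_nbhd (hG : G.IsCubicBip A B) (h : IsTorso T G A B φ t₁ t₂ x y)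
    [DecidablePred (· ∈ Set.range φ)]
    {Q : Finset V} (hQA : Q ⊆ A) (hQ : ∀ q ∈ Q, q ∉ Set.range φ) :
    #Q ≤ #((G.nbhd Q).filter (· ∉ Set.range φ)) ∧
      (y ∉ Q → Q.Nonempty → #Q + 1 ≤ #((G.nbhd Q).filter (· ∉ Set.range φ))) := by
  rcases Q.eq_empty_or_nonempty with rfl | hne
  · simp
  have hne' : Q ≠ A := by
    rintro rfl
    exact hQ _ h.cut.s_mem h.cut.mem_s
  have h1 := hG.card_add_one_le_nbhd hQA hne hne'
  have h2 := card_filter_add_card_filter_not (s := G.nbhd Q) (· ∈ Set.range φ)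
  have h3 : ∀ z ∈ (G.nbhd Q).filter (· ∈ Set.range φ), z = φ t₂ ∧ y ∈ Q := by
    intro z hz
    obtain ⟨hz, hzr⟩ := mem_filter.1 hz
    obtain ⟨q, hq, hqz⟩ := mem_nbhd.1 hz
    rcases h.cut.cross hzr (hQ q hq) hqz.symm with h4 | h4
    · exact absurd (hQA hq) (hG.notMem_left (h4.2 ▸ h.cut.t_mem))
    · exact ⟨h4.1, h4.2 ▸ hq⟩
  constructor
  · have h4 : #((G.nbhd Q).filter (· ∈ Set.range φ)) ≤ #{φ t₂} :=
      card_le_card fun z hz => mem_singleton.2 (h3 z hz).1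
    rw [card_singleton] at h4
    omega
  · intro hy _
    have h4 : (G.nbhd Q).filter (· ∈ Set.range φ) = ∅ :=
      eq_empty_of_forall_notMem fun z hz => hy (h3 z hz).2
    rw [h4, card_empty] at h2
    omega

/-- A violating set `S` in `G` is cut down to its trace on `T`. The part outside has at least as
many outer neighbours as vertices, so the trace is still deficient. The work is to account for the
new edge `t₁t₂`, which matters only if `φ t₁ ∈ S`. -/
theorem isNicePair_map (hG : G.IsCubicBip A B) (h : IsTorso T G A B φ t₁ t₂ x y) {a b : U}
    (ha : φ a ∈ A) (hb : φ b ∈ B) (hn : T.IsNicePair a b) : G.IsNicePair (φ a) (φ b) := by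
  classical
  have : Finite U := Finite.of_injective φ h.inj
  have : Fintype U := Fintype.ofFinite U
  rw [(h.isCubicBip hG).isNicePair_iff (mem_preimage.2 ha) (mem_preimage.2 hb)] at hn
  by_contra hcon
  rw [hG.isNicePair_iff ha hb] at hcon
  push Not at hcon
  obtain ⟨S, hSA, haS, hbS, hS⟩ := hcon
  set S' := S.preimage φ h.inj.injOn with hS'
  set N := (G.nbhd S).preimage φ h.inj.injOn with hN
  have memS' : ∀ u, u ∈ S' ↔ φ u ∈ S := fun u => mem_preimage
  have memN : ∀ u, u ∈ N ↔ ∃ s ∈ S, G.Adj s (φ u) := fun u => by rw [hN, mem_preimage, mem_nbhd]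
  have hS'A : S' ⊆ A.preimage φ h.inj.injOn := fun u hu => mem_preimage.2 (hSA ((memS' u).1 hu))
  have preim_card : ∀ R : Finset V, #(R.preimage φ h.inj.injOn) =
      #(R.filter (· ∈ Set.range φ)) := fun R => by
    rw [card_preimage]
  set Q := S.filter (· ∉ Set.range φ) with hQ
  have hQA : Q ⊆ A := (filter_subset _ _).trans hSA
  obtain ⟨hQ1, hQ2⟩ := h.card_le_outer_nbhd hG hQA fun q hq => (mem_filter.1 hq).2
  have c1 : #S' + #Q = #S := by
    rw [hS', preim_card, hQ]
    convert card_filter_add_card_filter_not (s := S) (· ∈ Set.range φ)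
  have c2 : #N + #((G.nbhd S).filter (· ∉ Set.range φ)) = #(G.nbhd S) := by
    rw [hN, preim_card]
    convert card_filter_add_card_filter_not (s := G.nbhd S) (· ∈ Set.range φ)
  have c3 : #((G.nbhd Q).filter (· ∉ Set.range φ)) ≤
      #((G.nbhd S).filter (· ∉ Set.range φ)) :=
    card_le_card (filter_subset_filter _ (nbhd_mono (filter_subset _ _)))
  have edge : ∀ u v, φ u ∈ A → T.Adj u v → ¬ (u = t₁ ∧ v = t₂) → G.Adj (φ u) (φ v) := by
    intro u v hu huv hne
    refine (h.adj_iff _ _).2 ⟨huv, fun he => ?_⟩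
    rcases Sym2.eq_iff.1 he with h1 | h1
    · exact hne h1
    · exact hG.notMem_right hu (h1.1 ▸ h.cut.u_mem)
  by_cases ht₁ : φ t₁ ∈ S
  -- If `y ∈ S`, then `φ t₂` is already a neighbour of `S` via `y`. Otherwise the outer part has a
  -- spare neighbour, which pays for the additional neighbour `t₂`.
  · by_cases hyS : y ∈ S
    · have hsub : T.nbhd S' ⊆ N := by
        intro v hv
        obtain ⟨u, hu, huv⟩ := mem_nbhd.1 hv
        by_cases he : u = t₁ ∧ v = t₂
        · exact (memN v).2 ⟨y, hyS, he.2 ▸ h.cut.adj_ur.symm⟩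
        · exact (memN v).2 ⟨φ u, (memS' u).1 hu, edge u v (hSA ((memS' u).1 hu)) huv he⟩
      have := card_le_card hsub
      have := hn S' hS'A ((memS' a).2 haS) (fun s hs hsb => by
        by_cases he : s = t₁ ∧ b = t₂
        · have := hbS y hyS (he.2 ▸ h.cut.adj_ur.symm)
          exact absurd ⟨a, this.symm⟩ h.cut.mem_r
        · exact h.inj (hbS _ ((memS' s).1 hs) (edge s b (hSA ((memS' s).1 hs)) hsb he)))
      omega
    · have hyQ : y ∉ Q := fun hy => hyS (mem_filter.1 hy).1
      have hout : #Q + 1 ≤ #((G.nbhd S).filter (· ∉ Set.range φ)) := by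
        rcases Q.eq_empty_or_nonempty with hQe | hQne
        · rw [hQe, card_empty, zero_add, Nat.succ_le_iff, card_pos]
          exact ⟨x, mem_filter.2 ⟨mem_nbhd.2 ⟨_, ht₁, h.cut.adj_st⟩, h.cut.mem_t⟩⟩
        · exact (hQ2 hyQ hQne).trans c3
      -- Here the new edge makes `t₁` inadmissible, so it is removed from the trace; the spare outer
      -- neighbour pays for the lost vertex.
      by_cases hbt : b = t₂ ∧ t₁ ≠ a
      · have hsub : T.nbhd (S'.erase t₁) ⊆ N := by
          intro v hv
          obtain ⟨u, hu, huv⟩ := mem_nbhd.1 hv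
          obtain ⟨hut, hu⟩ := mem_erase.1 hu
          exact (memN v).2 ⟨φ u, (memS' u).1 hu,
            edge u v (hSA ((memS' u).1 hu)) huv fun he => hut he.1⟩
        have := card_le_card hsub
        have := hn (S'.erase t₁) ((erase_subset _ _).trans hS'A)
          (mem_erase.2 ⟨hbt.2.symm, (memS' a).2 haS⟩) (fun s hs hsb => by
            obtain ⟨hst, hs⟩ := mem_erase.1 hs
            exact h.inj (hbS _ ((memS' s).1 hs) (edge s b (hSA ((memS' s).1 hs)) hsb
              fun he => hst he.1)))
        have ht' : t₁ ∈ S' := (memS' t₁).2 ht₁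
        have := card_pos.2 ⟨_, ht'⟩
        rw [card_erase_of_mem ht'] at *
        omega
      · have hsub : T.nbhd S' ⊆ insert t₂ N := by
          intro v hv
          obtain ⟨u, hu, huv⟩ := mem_nbhd.1 hv
          by_cases he : u = t₁ ∧ v = t₂
          · exact mem_insert.2 (Or.inl he.2)
          · exact mem_insert_of_mem
              ((memN v).2 ⟨φ u, (memS' u).1 hu, edge u v (hSA ((memS' u).1 hu)) huv he⟩)
        have := (card_le_card hsub).trans (card_insert_le _ _)
        have := hn S' hS'A ((memS' a).2 haS) (fun s hs hsb => by
          by_cases he : s = t₁ ∧ b = t₂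
          · push Not at hbt
            rw [he.1, hbt he.2]
          · exact h.inj (hbS _ ((memS' s).1 hs) (edge s b (hSA ((memS' s).1 hs)) hsb he)))
        omega
  · have hne : ∀ u ∈ S', ∀ v, ¬ (u = t₁ ∧ v = t₂) := by
      rintro u hu v ⟨rfl, rfl⟩
      exact ht₁ ((memS' _).1 hu)
    have hsub : T.nbhd S' ⊆ N := by
      intro v hv
      obtain ⟨u, hu, huv⟩ := mem_nbhd.1 hv
      exact (memN v).2 ⟨φ u, (memS' u).1 hu, edge u v (hSA ((memS' u).1 hu)) huv (hne u hu v)⟩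
    have := card_le_card hsub
    have := hn S' hS'A ((memS' a).2 haS) (fun s hs hsb =>
      h.inj (hbS _ ((memS' s).1 hs) (edge s b (hSA ((memS' s).1 hs)) hsb (hne s hs b))))
    omega

/-- A violating set of `T` is carried over to `G`. If it contains `t₁`, the outer neighbour `x`
appears; this is compensated either by losing `φ t₂` or by adding the whole `A`-part of the other
side, which is balanced. -/
theorem isNicePair_of_map (hG : G.IsCubicBip A B) (h : IsTorso T G A B φ t₁ t₂ x y) {a b : U}
    (ha : φ a ∈ A) (hb : φ b ∈ B) (hn : G.IsNicePair (φ a) (φ b)) : T.IsNicePair a b := by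
  classical
  have : Finite U := Finite.of_injective φ h.inj
  have : Fintype U := Fintype.ofFinite U
  by_contra hcon
  rw [(h.isCubicBip hG).isNicePair_iff (mem_preimage.2 ha) (mem_preimage.2 hb)] at hcon
  rw [hG.isNicePair_iff ha hb] at hn
  push Not at hcon
  obtain ⟨S, hSA, haS, hbS, hS⟩ := hcon
  have hPA : S.image φ ⊆ A := by
    intro z hz
    obtain ⟨u, hu, rfl⟩ := mem_image.1 hz
    exact mem_preimage.1 (hSA hu)
  have hPc : #(S.image φ) = #S := card_image_of_injective _ h.inj
  have hPb : ∀ s ∈ S.image φ, G.Adj s (φ b) → s = φ a := by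
    intro z hz hzb
    obtain ⟨u, hu, rfl⟩ := mem_image.1 hz
    rw [hbS u hu ((h.adj_iff _ _).1 hzb).1]
  have hcross : ∀ u ∈ S, ∀ z ∉ Set.range φ, G.Adj (φ u) z → u = t₁ ∧ z = x := by
    intro u hu z hz huz
    rcases h.cut.cross ⟨u, rfl⟩ hz huz with h1 | h1
    · exact ⟨h.inj h1.1, h1.2⟩
    · exact absurd (h1.1 ▸ mem_preimage.1 (hSA hu)) (hG.notMem_left h.cut.u_mem)
  by_cases ht₁ : t₁ ∈ S
  · have ht₂ : t₂ ∈ T.nbhd S := mem_nbhd.2 ⟨t₁, ht₁, h.adj⟩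
    by_cases hbt : b = t₂
    · have hsub : G.nbhd (S.image φ) ⊆ insert x (((T.nbhd S).erase t₂).image φ) := by
        intro z hz
        obtain ⟨w, hw, hwz⟩ := mem_nbhd.1 hz
        obtain ⟨u, hu, rfl⟩ := mem_image.1 hw
        by_cases hzr : z ∈ Set.range φ
        · obtain ⟨v, rfl⟩ := hzr
          obtain ⟨huv, hne⟩ := (h.adj_iff _ _).1 hwz
          refine mem_insert_of_mem (mem_image_of_mem _ (mem_erase.2 ⟨?_, mem_nbhd.2 ⟨u, hu, huv⟩⟩))
          rintro rfl
          have h1 := hbS u hu (hbt ▸ huv)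
          have h2 := hbS t₁ ht₁ (hbt ▸ h.adj)
          exact hne (by rw [h1, h2])
        · exact mem_insert.2 (Or.inl (hcross u hu z hzr hwz).2)
      have c1 := (card_le_card hsub).trans (card_insert_le _ _)
      have := card_pos.2 ⟨_, ht₂⟩
      rw [card_image_of_injective _ h.inj, card_erase_of_mem ht₂] at c1
      have := hn _ hPA (mem_image_of_mem _ haS) hPb
      omega
    · set XA := A.filter (· ∈ (Set.range φ)ᶜ) with hXA
      set XB := B.filter (· ∈ (Set.range φ)ᶜ) with hXB
      have hX : #XA = #XB := h.cut.compl.card_eq hG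
      have hdis : Disjoint (S.image φ) XA := by
        rw [Finset.disjoint_left]
        intro z hz hz'
        obtain ⟨u, hu, rfl⟩ := mem_image.1 hz
        exact (mem_filter.1 hz').2 ⟨u, rfl⟩
      have hsub : G.nbhd (S.image φ ∪ XA) ⊆ (T.nbhd S).image φ ∪ XB := by
        intro z hz
        obtain ⟨w, hw, hwz⟩ := mem_nbhd.1 hz
        rcases mem_union.1 hw with hw | hw
        · obtain ⟨u, hu, rfl⟩ := mem_image.1 hw
          by_cases hzr : z ∈ Set.range φ
          · obtain ⟨v, rfl⟩ := hzr
            exact mem_union_left _ (mem_image_of_mem _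
              (mem_nbhd.2 ⟨u, hu, ((h.adj_iff _ _).1 hwz).1⟩))
          · exact mem_union_right _ (mem_filter.2
              ⟨(hcross u hu z hzr hwz).2 ▸ h.cut.t_mem, hzr⟩)
        · obtain ⟨hwA, hwr⟩ := mem_filter.1 hw
          by_cases hzr : z ∈ Set.range φ
          · rcases h.cut.cross hzr hwr hwz.symm with h1 | h1
            · exact absurd (h1.2 ▸ hwA) (hG.notMem_left h.cut.t_mem)
            · exact mem_union_left _ (h1.1 ▸ mem_image_of_mem _ ht₂)
          · exact mem_union_right _ (mem_filter.2 ⟨hG.mem_right hwz hwA, hzr⟩)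
      have c1 := (card_le_card hsub).trans (card_union_le _ _)
      rw [card_image_of_injective _ h.inj] at c1
      have := hn (S.image φ ∪ XA) (union_subset hPA (filter_subset _ _))
        (mem_union_left _ (mem_image_of_mem _ haS)) (fun z hz hzb => by
          rcases mem_union.1 hz with hz | hz
          · exact hPb z hz hzb
          · obtain ⟨hzA, hzr⟩ := mem_filter.1 hz
            rcases h.cut.cross ⟨b, rfl⟩ hzr hzb.symm with h1 | h1
            · exact absurd (h1.2 ▸ hzA) (hG.notMem_left h.cut.t_mem)
            · exact absurd (h.inj h1.1) hbt)
      rw [card_union_of_disjoint hdis] at this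
      omega
  · have hsub : G.nbhd (S.image φ) ⊆ (T.nbhd S).image φ := by
      intro z hz
      obtain ⟨w, hw, hwz⟩ := mem_nbhd.1 hz
      obtain ⟨u, hu, rfl⟩ := mem_image.1 hw
      by_cases hzr : z ∈ Set.range φ
      · obtain ⟨v, rfl⟩ := hzr
        exact mem_image_of_mem _ (mem_nbhd.2 ⟨u, hu, ((h.adj_iff _ _).1 hwz).1⟩)
      · exact absurd ((hcross u hu z hzr hwz).1 ▸ hu) ht₁
    have c1 := card_le_card hsub
    rw [card_image_of_injective _ h.inj] at c1
    have := hn _ hPA (mem_image_of_mem _ haS) hPb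
    omega

end IsTorso

/-! ### Tight sets and graphs without 2-edge cuts -/

/-- A nonempty set of vertices of one colour with one more neighbour than vertices, which are not
all vertices of the other colour. -/
structure IsTight {V : Type*} [Fintype V] (G : SimpleGraph V) (A B S : Finset V) : Prop where
  subset : S ⊆ A
  nonempty : S.Nonempty
  card_le : #(G.nbhd S) ≤ #S + 1
  ne : G.nbhd S ≠ B

/-- `G` has no 2-edge cut. -/
def NoTwoCut {V : Type*} (G : SimpleGraph V) (A B : Finset V) : Prop :=
  ∀ W s t u r, ¬ G.IsTwoCut A B W s t u r

section
variable {V : Type*} {G : SimpleGraph V} {A B : Finset V}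

theorem NoTwoCut.symm (h : G.NoTwoCut A B) : G.NoTwoCut B A :=
  fun W s t u r hW => h W u r s t hW.swap

theorem IsNicePairSet.symm {A' B' : Finset V} (h : G.IsNicePairSet A B A' B') :
    G.IsNicePairSet B A B' A' :=
  ⟨h.2.1, h.1, fun b hb a ha => isNicePair_comm.1 (h.2.2 a ha b hb)⟩

variable [Fintype V]

/-- No vertex of `B \ N(S)` has a neighbour in `S`, so its neighbourhood lies in `A \ S`, and `#A =
#B` turns the bound for `S` into the one for the complement. -/
theorem IsTight.dual [DecidableEq V] (hG : G.IsCubicBip A B) {S : Finset V}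
    (h : G.IsTight A B S) : G.IsTight B A (B \ G.nbhd S) := by
  have hN := hG.nbhd_subset h.subset
  have hsub : G.nbhd (B \ G.nbhd S) ⊆ A \ S := by
    intro z hz
    obtain ⟨b, hb, hbz⟩ := mem_nbhd.1 hz
    obtain ⟨hb, hbS⟩ := mem_sdiff.1 hb
    exact mem_sdiff.2 ⟨hG.mem_left hbz hb, fun hzS => hbS (mem_nbhd.2 ⟨z, hzS, hbz.symm⟩)⟩
  refine ⟨sdiff_subset, ?_, ?_, ?_⟩
  · rw [sdiff_nonempty]
    exact fun h' => h.ne (Subset.antisymm hN h')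
  · have h1 := card_le_card hsub
    have h2 := card_sdiff_add_card_eq_card h.subset
    have h3 := card_sdiff_add_card_eq_card hN
    have h4 := hG.card_eq
    have h5 := h.card_le
    omega
  · intro he
    obtain ⟨s, hs⟩ := h.nonempty
    have := hsub (he ▸ h.subset hs)
    exact (mem_sdiff.1 this).2 hs

theorem IsTight.card_eq (hG : G.IsCubicBip A B) {S : Finset V} (h : G.IsTight A B S) :
    #(G.nbhd S) = #S + 1 := by
  have h1 := h.card_le
  have h2 := hG.card_add_one_le_nbhd h.subset h.nonempty (by
    rintro rfl
    refine h.ne (eq_of_subset_of_card_le (hG.nbhd_subset h.subset) ?_)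
    rw [← hG.card_eq]
    exact hG.card_le_nbhd h.subset)
  omega

theorem IsTight.two_le_card (hG : G.IsCubicBip A B) {S : Finset V} (h : G.IsTight A B S) :
    2 ≤ #S := by
  by_contra hlt
  have h1 := card_pos.2 h.nonempty
  have h2 : #S = 1 := by omega
  obtain ⟨s, rfl⟩ := card_eq_one.1 h2
  have h3 := h.card_le
  rw [hG.card_neighbors] at h3
  omega

/-- If `s` were the only neighbour of `t` in `S`, then all but one of the edges at `S` would end in
`N(S) \ {t}`. When `S ≠ A`, this set has `#S` vertices, so a single edge leaves it, and with `st`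
that is a 2-edge cut. For `S = A` the vertex `t` would have degree 1. -/
theorem exists_other_neighbor (hG : G.IsCubicBip A B) (h2 : G.NoTwoCut A B) {S : Finset V}
    (hS : S ⊆ A) (hc : #(G.nbhd S) ≤ #S + 1) {s t : V} (hs : s ∈ S) (hst : G.Adj s t) :
    ∃ s' ∈ S, s' ≠ s ∧ G.Adj s' t := by
  classical
  by_contra! hcon
  have huniq : ∀ s' ∈ S, G.Adj s' t → s' = s := by
    intro s' hs' hadj
    by_contra hne
    exact hcon s' hs' hne hadj
  have htB : t ∈ B := hG.mem_right hst (hS hs)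
  have hSA : S ≠ A := by
    rintro rfl
    have h3 : G.nbhd {t} ⊆ {s} := by
      intro z hz
      obtain ⟨t', ht', htz⟩ := mem_nbhd.1 hz
      rw [mem_singleton] at ht'
      subst ht'
      exact mem_singleton.2 (huniq z (hG.mem_left htz htB) htz.symm)
    have h4 := card_le_card h3
    rw [hG.card_neighbors, card_singleton] at h4
    omega
  have htN : t ∈ G.nbhd S := mem_nbhd.2 ⟨s, hs, hst⟩
  have hN := hG.nbhd_subset hS
  have c0 := hG.card_add_one_le_nbhd hS ⟨s, hs⟩ hSA
  have c1 := hG.edgeCount_nbhd hS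
  rw [edgeCount_add_sdiff (erase_subset t (G.nbhd S)), sdiff_erase htN, Finset.sdiff_self,
    insert_empty_eq] at c1
  have c2 : G.edgeCount S {t} = 1 := by
    rw [edgeCount_comm, edgeCount_eq_sum, sum_singleton, card_eq_one]
    refine ⟨s, ?_⟩
    ext z
    simp only [mem_filter, mem_singleton]
    exact ⟨fun hz => huniq z hz.1 hz.2.symm, fun hz => hz ▸ ⟨hs, hst.symm⟩⟩
  have c3 := hG.symm.edgeCount_right ((erase_subset t _).trans hN)
  rw [edgeCount_add_sdiff hS, edgeCount_comm, card_erase_of_mem htN] at c3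
  have c4 : G.edgeCount ((G.nbhd S).erase t) (A \ S) = 1 := by omega
  unfold edgeCount at c4
  obtain ⟨⟨u, r⟩, hur⟩ := card_eq_one.1 c4
  have mur : ∀ p : V × V, p = (u, r) ↔ ((p.1 ≠ t ∧ p.1 ∈ G.nbhd S) ∧ p.2 ∈ A ∧ p.2 ∉ S) ∧
      G.Adj p.1 p.2 := by
    intro p
    rw [← mem_singleton, ← hur, mem_filter, mem_product, mem_erase, mem_sdiff]
  obtain ⟨⟨⟨hut, huN⟩, hrA, hrS⟩, hadj⟩ := (mur (u, r)).1 rfl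
  refine h2 {z | z ∈ S ∨ (z ≠ t ∧ z ∈ G.nbhd S)} s t u r ⟨Or.inl hs, ?_, Or.inr ⟨hut, huN⟩, ?_,
    hS hs, htB, hN huN, hrA, hst, hadj, ?_⟩
  · rintro (h | h)
    · exact hG.notMem_left htB (hS h)
    · exact h.1 rfl
  · rintro (h | h)
    · exact hrS h
    · exact hG.notMem_right hrA (hN h.2)
  · rintro z (hz | hz) w hw hzw
    · have hwN : w ∈ G.nbhd S := mem_nbhd.2 ⟨z, hz, hzw⟩
      have hwt : w = t := by
        by_contra hne
        exact hw (Or.inr ⟨hne, hwN⟩)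
      subst hwt
      exact Or.inl ⟨huniq z hz hzw, rfl⟩
    · exact Or.inr (Prod.ext_iff.1 ((mur (z, w)).2
        ⟨⟨hz, hG.mem_left hzw (hN hz.2), fun h => hw (Or.inl h)⟩, hzw⟩))

theorem exists_isTight (hG : G.IsCubicBip A B) (h2 : G.NoTwoCut A B) {a b : V} (ha : a ∈ A)
    (hb : b ∈ B) (hn : ¬ G.IsNicePair a b) : ∃ S, G.IsTight A B S ∧ a ∈ S ∧ b ∉ G.nbhd S := by
  rw [hG.isNicePair_iff ha hb] at hn
  push Not at hn
  obtain ⟨S, hSA, haS, hbS, hS⟩ := hn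
  have hc : #(G.nbhd S) ≤ #S + 1 := by omega
  have hbN : b ∉ G.nbhd S := by
    intro hbN
    obtain ⟨s, hs, hsb⟩ := mem_nbhd.1 hbN
    obtain ⟨s', hs', hne, hsb'⟩ := exists_other_neighbor hG h2 hSA hc hs hsb
    exact hne ((hbS s' hs' hsb').trans (hbS s hs hsb).symm)
  exact ⟨S, ⟨hSA, ⟨a, haS⟩, hc, fun he => hbN (he ▸ hb)⟩, haS, hbN⟩

/-- Uncrossing: a tight `S₁` that separates `a` from `b` would meet `S` in a tight set, by
submodularity of the size of the neighbourhood. Minimality then gives `S ⊆ S₁`, so `b ∈ N(S₁)`. -/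
theorem IsTight.isNicePair_of_minimal (hG : G.IsCubicBip A B) (h2 : G.NoTwoCut A B)
    {S : Finset V} (hS : G.IsTight A B S) (hminA : ∀ S', G.IsTight A B S' → #S ≤ #S')
    (hminB : ∀ T, G.IsTight B A T → #S ≤ #T) {a b : V} (ha : a ∈ S) (hb : b ∈ G.nbhd S) :
    G.IsNicePair a b := by
  classical
  by_contra hn
  obtain ⟨S₁, hS₁, haS₁, hbS₁⟩ :=
    exists_isTight hG h2 (hS.subset ha) (hG.nbhd_subset hS.subset hb) hn
  have haI : a ∈ S ∩ S₁ := mem_inter.2 ⟨ha, haS₁⟩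
  have c1 := hS.card_eq hG
  have c2 := hS₁.card_eq hG
  have c3 := card_union_add_card_inter S S₁
  have hUA : S ∪ S₁ ⊆ A := union_subset hS.subset hS₁.subset
  -- Submodularity is of no use here, as the union need not have a surplus neighbour. Instead the
  -- dual tight set `B \ N(S₁)` is smaller than `S`.
  by_cases hU : S ∪ S₁ = A
  · have c4 := hminB _ (hS₁.dual hG)
    have c5 := card_sdiff_add_card_eq_card (hG.nbhd_subset hS₁.subset)
    have c6 := hG.card_eq
    have c7 := card_pos.2 ⟨a, haI⟩
    rw [hU] at c3
    omega
  · have c4 := hG.card_add_one_le_nbhd hUA ⟨a, mem_union_left _ ha⟩ hU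
    rw [nbhd_union] at c4
    have c5 := card_union_add_card_inter (G.nbhd S) (G.nbhd S₁)
    have hsub : G.nbhd (S ∩ S₁) ⊆ G.nbhd S ∩ G.nbhd S₁ :=
      subset_inter (nbhd_mono inter_subset_left) (nbhd_mono inter_subset_right)
    have c6 := card_le_card hsub
    have hI : G.IsTight A B (S ∩ S₁) := by
      refine ⟨inter_subset_left.trans hS.subset, ⟨a, haI⟩, by omega, fun he => ?_⟩
      have := hsub (he ▸ hG.nbhd_subset hS.subset hb)
      exact hbS₁ (mem_inter.1 this).2
    have hSS : S ∩ S₁ = S := eq_of_subset_of_card_le inter_subset_left (hminA _ hI)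
    exact hbS₁ (nbhd_mono (inter_eq_left.1 hSS) hb)

theorem IsTight.exists_isNicePairSet (hG : G.IsCubicBip A B) (h2 : G.NoTwoCut A B)
    {S : Finset V} (hS : G.IsTight A B S) (hminA : ∀ S', G.IsTight A B S' → #S ≤ #S')
    (hminB : ∀ T, G.IsTight B A T → #S ≤ #T) :
    ∃ A' B', G.IsNicePairSet A B A' B' ∧ 3 ≤ #A' ∧ 3 ≤ #B' ∧ (4 ≤ #A' ∨ 4 ≤ #B') := by
  classical
  have hN := hG.nbhd_subset hS.subset
  have c1 := hS.card_eq hG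
  have c2 := hS.two_le_card hG
  by_cases hS3 : 3 ≤ #S
  · exact ⟨S, G.nbhd S, ⟨hS.subset, hN, fun a ha b hb =>
      hS.isNicePair_of_minimal hG h2 hminA hminB ha hb⟩, hS3, by omega, by omega⟩
  have c3 : #S = 2 := by omega
  have hadj : ∀ u ∈ G.nbhd S, ∀ s ∈ S, G.Adj s u := by
    intro u hu s hs
    obtain ⟨s₁, hs₁, h₁⟩ := mem_nbhd.1 hu
    obtain ⟨s₂, hs₂, hne, h₂'⟩ := exists_other_neighbor hG h2 hS.subset hS.card_le hs₁ h₁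
    have hsub : ({s₁, s₂} : Finset V) ⊆ S := insert_subset hs₁ (singleton_subset_iff.2 hs₂)
    have he : ({s₁, s₂} : Finset V) = S := eq_of_subset_of_card_le hsub (by
      rw [card_pair hne.symm, c3])
    rw [← he, mem_insert, mem_singleton] at hs
    rcases hs with rfl | rfl
    · exact h₁
    · exact h₂'
  have hne : (G.nbhd S).Nonempty := by
    rw [← card_pos]
    omega
  have c4 := hG.symm.card_add_one_le_nbhd hN hne hS.ne
  refine ⟨G.nbhd (G.nbhd S), G.nbhd S, ⟨hG.symm.nbhd_subset hN, hN, fun a ha b hb => ?_⟩,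
    by omega, by omega, by omega⟩
  by_cases haS : a ∈ S
  · exact hS.isNicePair_of_minimal hG h2 hminA hminB haS hb
  by_contra hn
  obtain ⟨S₁, hS₁, haS₁, hbS₁⟩ := exists_isTight hG h2 (hG.symm.nbhd_subset hN ha) (hN hb) hn
  have hdis : ∀ s ∈ S, s ∉ S₁ := fun s hs hs₁ => hbS₁ (mem_nbhd.2 ⟨s, hs₁, hadj b hb s hs⟩)
  obtain ⟨u, hu, hua⟩ := mem_nbhd.1 ha
  obtain ⟨s', hs', hne', hs'u⟩ :=
    exists_other_neighbor hG h2 hS₁.subset hS₁.card_le haS₁ hua.symm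
  have hsub : insert s' (insert a S) ⊆ G.nbhd {u} := by
    intro z hz
    refine mem_nbhd.2 ⟨u, mem_singleton_self u, ?_⟩
    rcases mem_insert.1 hz with rfl | hz
    · exact hs'u.symm
    rcases mem_insert.1 hz with rfl | hz
    · exact hua
    · exact (hadj u hu z hz).symm
  have c5 := card_le_card hsub
  rw [hG.card_neighbors, card_insert_of_notMem, card_insert_of_notMem haS] at c5
  · omega
  · rw [mem_insert, not_or]
    exact ⟨hne', fun h => hdis _ h hs'⟩

theorem exists_isNicePairSet_of_noTwoCut (hG : G.IsCubicBip A B) (h2 : G.NoTwoCut A B) :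
    ∃ A' B', G.IsNicePairSet A B A' B' ∧ 3 ≤ #A' ∧ 3 ≤ #B' ∧
      (4 ≤ #A → 4 ≤ #A' ∨ 4 ≤ #B') := by
  classical
  by_cases hex : ∃ S, G.IsTight A B S
  · have hex' : ∃ n, ∃ S, (G.IsTight A B S ∨ G.IsTight B A S) ∧ #S = n :=
      ⟨_, hex.choose, Or.inl hex.choose_spec, rfl⟩
    obtain ⟨S, hS, hSn⟩ := Nat.find_spec hex'
    have hmin : ∀ S', (G.IsTight A B S' ∨ G.IsTight B A S') → #S ≤ #S' := fun S' h => by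
      rw [hSn]
      exact Nat.find_min' hex' ⟨S', h, rfl⟩
    rcases hS with hS | hS
    · obtain ⟨A', B', h, h3, h3', h4⟩ := hS.exists_isNicePairSet hG h2
        (fun S' h => hmin S' (Or.inl h)) fun S' h => hmin S' (Or.inr h)
      exact ⟨A', B', h, h3, h3', fun _ => h4⟩
    · obtain ⟨B', A', h, h3, h3', h4⟩ := hS.exists_isNicePairSet hG.symm h2.symm
        (fun S' h => hmin S' (Or.inr h)) fun S' h => hmin S' (Or.inl h)
      exact ⟨A', B', h.symm, h3', h3, fun _ => h4.symm⟩
  · have hA : 3 ≤ #A := by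
      obtain ⟨v⟩ := hG.conn.nonempty
      rcases hG.mem_or_mem v with hv | hv
      · rw [hG.card_eq, ← hG.card_neighbors v]
        exact card_le_card (hG.nbhd_subset (singleton_subset_iff.2 hv))
      · rw [← hG.card_neighbors v]
        exact card_le_card (hG.symm.nbhd_subset (singleton_subset_iff.2 hv))
    refine ⟨A, B, ⟨Subset.refl _, Subset.refl _, fun a ha b hb => ?_⟩, hA, hG.card_eq ▸ hA,
      fun h => Or.inl h⟩
    by_contra hn
    obtain ⟨S, hS, -⟩ := exists_isTight hG h2 ha hb hn
    exact hex ⟨S, hS⟩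

end

/-- The side `W` of a 2-edge cut together with a new edge `su`. -/
def torsoGraph {V : Type*} (G : SimpleGraph V) (W : Set V) (s u : V) : SimpleGraph W :=
  (G ⊔ edge s u).induce W

/-- Nice pair sets with two nonempty sides have sides of size at most 3. -/
def NiceBounded {V : Type*} (G : SimpleGraph V) (A B : Finset V) : Prop :=
  ∀ A' B' : Finset V, A'.Nonempty → B'.Nonempty → G.IsNicePairSet A B A' B' →
    #A' ≤ 3 ∧ #B' ≤ 3

section
variable {V : Type*} {G : SimpleGraph V} {A B : Finset V}

theorem IsTwoCut.isTorso {W : Set V} {s t u r : V} (hG : G.IsCubicBip A B)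
    (h : G.IsTwoCut A B W s t u r) (hsu : ¬ G.Adj s u) :
    IsTorso (G.torsoGraph W s u) G A B Subtype.val ⟨s, h.mem_s⟩ ⟨u, h.mem_u⟩ t r := by
  have hne : s ≠ u := by
    rintro rfl
    exact hG.notMem_right h.s_mem h.u_mem
  refine ⟨Subtype.val_injective, ?_, ?_, fun x y => ?_⟩
  · simp [torsoGraph, edge_adj, hne]
  · rw [Subtype.range_coe]
    exact h
  · have hxy : x.1 = y.1 → ¬ G.Adj x.1 y.1 := fun h h' => h'.ne h
    simp only [torsoGraph, comap_adj, Function.Embedding.subtype_apply, sup_adj, edge_adj, ne_eq,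
      Sym2.eq_iff, Subtype.ext_iff, not_or, not_and]
    constructor
    · intro hadj
      refine ⟨Or.inl hadj, ?_, ?_⟩
      · intro h1 h2
        exact hsu (h1 ▸ h2 ▸ hadj)
      · intro h1 h2
        exact hsu (h1 ▸ h2 ▸ hadj.symm)
    · rintro ⟨h1 | ⟨h1 | h1, -⟩, h2, h3⟩
      · exact h1
      · exact absurd h1.2 (h2 h1.1)
      · exact absurd h1.2 (h3 h1.1)

theorem IsCubicBip.exists_third_neighbor (hG : G.IsCubicBip A B) {v x y : V} (hx : G.Adj v x)
    (hy : G.Adj v y) (hxy : x ≠ y) :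
    ∃ z, z ≠ x ∧ z ≠ y ∧ ∀ w, G.Adj v w ↔ w = x ∨ w = y ∨ w = z := by
  obtain ⟨a, b, c, hab, hac, hbc, he⟩ := hG.exists_neighbors v
  have h1 := (he x).1 hx
  have h2 := (he y).1 hy
  simp only [he]
  rcases h1 with rfl | rfl | rfl <;> rcases h2 with rfl | rfl | rfl
  · exact absurd rfl hxy
  · exact ⟨c, hac.symm, hbc.symm, fun w => by tauto⟩
  · exact ⟨b, hab.symm, hbc, fun w => by tauto⟩
  · exact ⟨c, hbc.symm, hac.symm, fun w => by tauto⟩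
  · exact absurd rfl hxy
  · exact ⟨a, hab, hac, fun w => by tauto⟩
  · exact ⟨b, hbc, hab.symm, fun w => by tauto⟩
  · exact ⟨a, hac, hab, fun w => by tauto⟩
  · exact absurd rfl hxy

/-- If the ends `s` and `u` of the edges of a 2-edge cut of `W` are adjacent, then they can be
removed from `W`. -/
theorem IsTwoCut.shrink {W : Set V} {s t u r : V} (hG : G.IsCubicBip A B)
    (h : G.IsTwoCut A B W s t u r) (hsu : G.Adj s u) :
    ∃ s' u', G.IsTwoCut A B (W \ {s, u}) u' u s' s := by
  have hut : u ≠ t := fun h' => h.mem_t (h' ▸ h.mem_u)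
  have hsr : s ≠ r := fun h' => h.mem_r (h' ▸ h.mem_s)
  obtain ⟨s', hs'u, hs't, hs⟩ := hG.exists_third_neighbor hsu h.adj_st hut
  obtain ⟨u', hu's, hu'r, hu⟩ := hG.exists_third_neighbor hsu.symm h.adj_ur hsr
  have hss' : G.Adj s s' := (hs s').2 (Or.inr (Or.inr rfl))
  have huu' : G.Adj u u' := (hu u').2 (Or.inr (Or.inr rfl))
  have hs'B := hG.mem_right hss' h.s_mem
  have hu'A := hG.mem_left huu' h.u_mem
  have hne : s ≠ u := hsu.ne
  have hs'W : s' ∈ W := by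
    by_contra hs'W
    rcases h.cross h.mem_s hs'W hss' with h1 | h1
    · exact hs't h1.2
    · exact hne h1.1
  have hu'W : u' ∈ W := by
    by_contra hu'W
    rcases h.cross h.mem_u hu'W huu' with h1 | h1
    · exact hne h1.1.symm
    · exact hu'r h1.2
  refine ⟨s', u', ⟨hu'W, ?_⟩, fun h' => h'.2 (Or.inr rfl), ⟨hs'W, ?_⟩, fun h' => h'.2 (Or.inl rfl),
    hu'A, h.u_mem, hs'B, h.s_mem, huu'.symm, hss'.symm, ?_⟩
  · rintro (h1 | h1)
    · exact hu's h1
    · exact huu'.ne h1.symm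
  · rintro (h1 | h1)
    · exact hss'.ne h1.symm
    · exact hs'u h1
  · rintro x ⟨hxW, hxne⟩ y hy hxy
    have hxs : x ≠ s := fun h' => hxne (Or.inl h')
    have hxu : x ≠ u := fun h' => hxne (Or.inr h')
    by_cases hyW : y ∈ W
    · have hy' : y = s ∨ y = u := by
        by_contra hcon
        exact hy ⟨hyW, fun h' => hcon h'⟩
      rcases hy' with rfl | rfl
      · rcases (hs x).1 hxy.symm with h1 | h1 | h1
        · exact absurd h1 hxu
        · exact absurd (h1 ▸ hxW) h.mem_t
        · exact Or.inr ⟨h1, rfl⟩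
      · rcases (hu x).1 hxy.symm with h1 | h1 | h1
        · exact absurd h1 hxs
        · exact absurd (h1 ▸ hxW) h.mem_r
        · exact Or.inl ⟨h1, rfl⟩
    · rcases h.cross hxW hyW hxy with h1 | h1
      · exact absurd h1.1 hxs
      · exact absurd h1.1 hxu

/-- If the ends `t` and `r` of the edges of a 2-edge cut of `W` are adjacent, then they can be
added to `W`. -/
theorem IsTwoCut.extend {W : Set V} {s t u r : V} (hG : G.IsCubicBip A B)
    (h : G.IsTwoCut A B W s t u r) (htr : G.Adj t r) :
    ∃ t' r', G.IsTwoCut A B (W ∪ {t, r}) r t' t r' := by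
  obtain ⟨s', u', h'⟩ := h.compl.shrink hG htr.symm
  have := h'.compl
  rw [Set.compl_sdiff, compl_compl, Set.union_comm, Set.pair_comm] at this
  exact ⟨s', u', this⟩

namespace IsTorso

variable {U : Type*} {T : SimpleGraph U} {φ : U → V} {t₁ t₂ : U} {x y : V} [Fintype V]

theorem exists_isTwoCut_image (hG : G.IsCubicBip A B) (h : IsTorso T G A B φ t₁ t₂ x y)
    {W : Set U} {A' B' : Finset U} {s t u r : U} (hW : T.IsTwoCut A' B' W s t u r)
    (ht₂ : t₂ ∉ W) : ∃ s t u r, G.IsTwoCut A B (φ '' W) s t u r := by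
  have huniv : φ '' W ≠ Set.univ := by
    intro he
    have : x ∈ φ '' W := he ▸ Set.mem_univ x
    exact h.cut.mem_t (Set.image_subset_range _ _ this)
  have hne : (φ '' W).Nonempty := ⟨_, Set.mem_image_of_mem _ hW.mem_s⟩
  have inner : ∀ v ∈ W, ∀ z, z ∉ φ '' W → z ∈ Set.range φ → G.Adj (φ v) z →
      ∃ w, φ w = z ∧ s(v, w) ≠ s(t₁, t₂) ∧ ((v = s ∧ w = t) ∨ (v = u ∧ w = r)) := by
    rintro v hv _ hz ⟨w, rfl⟩ hadj
    obtain ⟨h1, h2⟩ := (h.adj_iff _ _).1 hadj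
    exact ⟨w, rfl, h2, hW.cross hv (fun hw => hz ⟨w, hw, rfl⟩) h1⟩
  have outer : ∀ v ∈ W, ∀ z, z ∉ Set.range φ → G.Adj (φ v) z → v = t₁ ∧ z = x := by
    intro v hv z hz hadj
    rcases h.cut.cross ⟨v, rfl⟩ hz hadj with h1 | h1
    · exact ⟨h.inj h1.1, h1.2⟩
    · exact absurd (h.inj h1.1 ▸ hv) ht₂
  by_cases ht₁ : t₁ ∈ W
  · have key : ∃ a b, ∀ v ∈ W, ∀ w, s(v, w) ≠ s(t₁, t₂) →
        ((v = s ∧ w = t) ∨ (v = u ∧ w = r)) → v = a ∧ w = b := by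
      rcases hW.cross ht₁ ht₂ h.adj with h1 | h1
      · refine ⟨u, r, fun v _ w hvw h' => h'.resolve_left fun h2 => hvw ?_⟩
        rw [h1.1, h1.2, h2.1, h2.2]
      · refine ⟨s, t, fun v _ w hvw h' => h'.resolve_right fun h2 => hvw ?_⟩
        rw [h1.1, h1.2, h2.1, h2.2]
    obtain ⟨a, b, hab⟩ := key
    refine hG.exists_isTwoCut hne huniv (x₁ := φ t₁) (y₁ := x) (x₂ := φ a) (y₂ := φ b) ?_
    rintro _ ⟨v, hv, rfl⟩ z hz hadj
    by_cases hzr : z ∈ Set.range φ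
    · obtain ⟨w, rfl, hne', hvw⟩ := inner v hv z hz hzr hadj
      obtain ⟨rfl, rfl⟩ := hab v hv w hne' hvw
      exact Or.inr ⟨rfl, rfl⟩
    · obtain ⟨rfl, rfl⟩ := outer v hv z hzr hadj
      exact Or.inl ⟨rfl, rfl⟩
  · refine hG.exists_isTwoCut hne huniv (x₁ := φ s) (y₁ := φ t) (x₂ := φ u) (y₂ := φ r) ?_
    rintro _ ⟨v, hv, rfl⟩ z hz hadj
    by_cases hzr : z ∈ Set.range φ
    · obtain ⟨w, rfl, -, hvw⟩ := inner v hv z hz hzr hadj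
      rcases hvw with ⟨rfl, rfl⟩ | ⟨rfl, rfl⟩
      · exact Or.inl ⟨rfl, rfl⟩
      · exact Or.inr ⟨rfl, rfl⟩
    · exact absurd ((outer v hv z hzr hadj).1 ▸ hv) ht₁

theorem noTwoCut (hG : G.IsCubicBip A B) (h : IsTorso T G A B φ t₁ t₂ x y)
    (hmin : ∀ W s t u r, G.IsTwoCut A B W s t u r → (Set.range φ).ncard ≤ W.ncard)
    (A' B' : Finset U) : T.NoTwoCut A' B' := by
  have key : ∀ W s t u r, T.IsTwoCut A' B' W s t u r → t₁ ∈ W ∧ t₂ ∈ W := by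
    have small : ∀ W s t u r, T.IsTwoCut A' B' W s t u r →
        (φ '' W).ncard < (Set.range φ).ncard := by
      intro W s t u r hW
      refine Set.ncard_lt_ncard ⟨Set.image_subset_range _ _, fun hsub => ?_⟩
      obtain ⟨w, hw, hwt⟩ := hsub ⟨t, rfl⟩
      exact hW.mem_t (h.inj hwt ▸ hw)
    intro W s t u r hW
    constructor
    · by_contra ht₁
      obtain ⟨_, _, _, _, hc⟩ := h.swap.exists_isTwoCut_image hG.symm hW ht₁
      exact absurd (hmin _ _ _ _ _ hc.swap) (not_le.2 (small _ _ _ _ _ hW))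
    · by_contra ht₂
      obtain ⟨_, _, _, _, hc⟩ := h.exists_isTwoCut_image hG hW ht₂
      exact absurd (hmin _ _ _ _ _ hc) (not_le.2 (small _ _ _ _ _ hW))
  intro W s t u r hW
  exact (key _ _ _ _ _ hW.compl).1 (key _ _ _ _ _ hW).1

theorem isNicePairSet_image [DecidableEq V] (hG : G.IsCubicBip A B)
    (h : IsTorso T G A B φ t₁ t₂ x y) {A' B' : Finset U}
    (hs : T.IsNicePairSet (A.preimage φ h.inj.injOn) (B.preimage φ h.inj.injOn) A' B') :
    G.IsNicePairSet A B (A'.image φ) (B'.image φ) := by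
  have hA : ∀ a ∈ A', φ a ∈ A := fun a ha => mem_preimage.1 (hs.1 ha)
  have hB : ∀ b ∈ B', φ b ∈ B := fun b hb => mem_preimage.1 (hs.2.1 hb)
  refine ⟨image_subset_iff.2 hA, image_subset_iff.2 hB, fun a ha b hb => ?_⟩
  obtain ⟨a, ha', rfl⟩ := mem_image.1 ha
  obtain ⟨b, hb', rfl⟩ := mem_image.1 hb
  exact h.isNicePair_map hG (hA a ha') (hB b hb') (hs.2.2 a ha' b hb')

theorem niceBounded (hG : G.IsCubicBip A B) (h : IsTorso T G A B φ t₁ t₂ x y)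
    (hP : G.NiceBounded A B) :
    T.NiceBounded (A.preimage φ h.inj.injOn) (B.preimage φ h.inj.injOn) := by
  classical
  intro A' B' hA hB hs
  have := hP _ _ (hA.image φ) (hB.image φ) (h.isNicePairSet_image hG hs)
  rwa [card_image_of_injective _ h.inj, card_image_of_injective _ h.inj] at this

end IsTorso

variable [Fintype V]

theorem exists_minimal_isTwoCut (hG : G.IsCubicBip A B) (h : ¬ G.NoTwoCut A B) :
    ∃ W s t u r, ∃ _ : G.IsTwoCut A B W s t u r, ¬ G.Adj s u ∧
      ∀ W' s t u r, G.IsTwoCut A B W' s t u r → W.ncard ≤ W'.ncard := by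
  classical
  have hex : ∃ n, ∃ W s t u r, G.IsTwoCut A B W s t u r ∧ W.ncard = n := by
    unfold NoTwoCut at h
    push Not at h
    obtain ⟨W, s, t, u, r, h⟩ := h
    exact ⟨_, W, s, t, u, r, h, rfl⟩
  obtain ⟨W, s, t, u, r, hW, hn⟩ := Nat.find_spec hex
  have hmin : ∀ W' s t u r, G.IsTwoCut A B W' s t u r → W.ncard ≤ W'.ncard := by
    intro W' s t u r hW'
    rw [hn]
    exact Nat.find_min' hex ⟨W', s, t, u, r, hW', rfl⟩
  refine ⟨W, s, t, u, r, hW, fun hsu => ?_, hmin⟩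
  obtain ⟨s', u', hW'⟩ := hW.shrink hG hsu
  refine absurd (hmin _ _ _ _ _ hW') (not_le.2 (Set.ncard_lt_ncard ⟨Set.sdiff_subset, ?_⟩))
  exact fun hsub => (hsub hW.mem_s).2 (Or.inl rfl)

theorem IsCubicBip.exists_isNicePairSet (hG : G.IsCubicBip A B) :
    ∃ A' B', G.IsNicePairSet A B A' B' ∧ 3 ≤ #A' ∧ 3 ≤ #B' := by
  classical
  by_cases h2 : G.NoTwoCut A B
  · obtain ⟨A', B', h, h3, h3', -⟩ := exists_isNicePairSet_of_noTwoCut hG h2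
    exact ⟨A', B', h, h3, h3'⟩
  obtain ⟨W, s, t, u, r, hW, hsu, hmin⟩ := exists_minimal_isTwoCut hG h2
  have hT := hW.isTorso hG hsu
  obtain ⟨A', B', h, h3, h3', -⟩ := exists_isNicePairSet_of_noTwoCut (hT.isCubicBip hG)
    (hT.noTwoCut hG (by rwa [Subtype.range_coe]) _ _)
  refine ⟨_, _, hT.isNicePairSet_image hG h, ?_, ?_⟩ <;>
    rwa [card_image_of_injective _ hT.inj]

theorem IsCubicBip.nonempty_iso_K33 (hG : G.IsCubicBip A B) (h2 : G.NoTwoCut A B)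
    (hP : G.NiceBounded A B) : Nonempty (G ≃g K33) := by
  classical
  have hA : #A ≤ 3 := by
    by_contra hlt
    obtain ⟨A', B', h, h3, h3', h4⟩ := exists_isNicePairSet_of_noTwoCut hG h2
    have h5 := hP A' B' (card_pos.1 (by omega)) (card_pos.1 (by omega)) h
    have h6 := h4 (by omega)
    omega
  have hadj : ∀ a ∈ A, ∀ b ∈ B, G.Adj a b := by
    intro a ha b hb
    have hsub := hG.nbhd_subset (singleton_subset_iff.2 ha)
    have he := eq_of_subset_of_card_le hsub (by rw [hG.card_neighbors, ← hG.card_eq]; exact hA)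
    rw [← he] at hb
    obtain ⟨a', ha', hab⟩ := mem_nbhd.1 hb
    rw [mem_singleton] at ha'
    exact ha' ▸ hab
  have hA3 : #A = 3 := by
    obtain ⟨v⟩ := hG.conn.nonempty
    rcases hG.mem_or_mem v with hv | hv
    · have := card_le_card (hG.nbhd_subset (singleton_subset_iff.2 hv))
      rw [hG.card_neighbors, ← hG.card_eq] at this
      omega
    · have := card_le_card (hG.symm.nbhd_subset (singleton_subset_iff.2 hv))
      rw [hG.card_neighbors] at this
      omega
  have hB3 : #B = 3 := by rw [← hG.card_eq, hA3]
  let eA : A ≃ Fin 3 := Fintype.equivFinOfCardEq (by rw [Fintype.card_coe, hA3])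
  let eB : B ≃ Fin 3 := Fintype.equivFinOfCardEq (by rw [Fintype.card_coe, hB3])
  let f : Fin 3 ⊕ Fin 3 → V := Sum.elim (fun i => (eA.symm i).1) fun i => (eB.symm i).1
  have hf1 : ∀ i, f (Sum.inl i) ∈ A := fun i => (eA.symm i).2
  have hf2 : ∀ i, f (Sum.inr i) ∈ B := fun i => (eB.symm i).2
  have hbij : Function.Bijective f := by
    constructor
    · rintro (i | i) (j | j) hij
      · exact congrArg _ (eA.symm.injective (Subtype.ext hij))
      · exact absurd (hij ▸ hf1 i) (hG.notMem_left (hf2 j))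
      · exact absurd (hij ▸ hf2 i) (hG.notMem_right (hf1 j))
      · exact congrArg _ (eB.symm.injective (Subtype.ext hij))
    · intro v
      rcases hG.mem_or_mem v with hv | hv
      · exact ⟨Sum.inl (eA ⟨v, hv⟩), by simp [f]⟩
      · exact ⟨Sum.inr (eB ⟨v, hv⟩), by simp [f]⟩
  refine ⟨(⟨Equiv.ofBijective f hbij, ?_⟩ : K33 ≃g G).symm⟩
  rintro (i | i) (j | j) <;>
    simp only [Equiv.ofBijective_apply, K33, completeBipartiteGraph_adj, Sum.isLeft_inl,
      Sum.isRight_inl, Sum.isLeft_inr, Sum.isRight_inr, Bool.false_eq_true, and_false, false_and,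
      or_self, and_self, or_true, true_or, iff_true, iff_false]
  · exact fun h => hG.notMem_right (hf1 j) (hG.mem_right h (hf1 i))
  · exact hadj _ (hf1 i) _ (hf2 j)
  · exact (hadj _ (hf1 j) _ (hf2 i)).symm
  · exact fun h => hG.notMem_left (hf2 j) (hG.mem_left h (hf2 i))

end

section
variable {U V W : Type*}

theorem edgeSpliceMap_left {x₁ x₂ : U} {y₁ y₂ : W} :
    edgeSpliceMap x₁ x₂ y₁ y₂ y₁ = Sum.inl x₁ := by
  simp [edgeSpliceMap]

theorem edgeSpliceMap_right {x₁ x₂ : U} {y₁ y₂ : W} (hy : y₁ ≠ y₂) :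
    edgeSpliceMap x₁ x₂ y₁ y₂ y₂ = Sum.inl x₂ := by
  simp [edgeSpliceMap, hy.symm]

theorem edgeSpliceMap_of_ne {x₁ x₂ : U} {y₁ y₂ w : W} (h₁ : w ≠ y₁) (h₂ : w ≠ y₂) :
    edgeSpliceMap x₁ x₂ y₁ y₂ w = Sum.inr ⟨w, h₁, h₂⟩ := by
  simp [edgeSpliceMap, h₁, h₂]

theorem eq_or_eq_of_edgeSpliceMap {x₁ x₂ u : U} {y₁ y₂ w : W}
    (h : edgeSpliceMap x₁ x₂ y₁ y₂ w = Sum.inl u) : (w = y₁ ∧ u = x₁) ∨ (w = y₂ ∧ u = x₂) := by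
  by_cases h₁ : w = y₁
  · simp only [edgeSpliceMap, h₁, dite_true, Sum.inl.injEq] at h
    exact Or.inl ⟨h₁, h.symm⟩
  · by_cases h₂ : w = y₂
    · subst h₂
      simp only [edgeSpliceMap, h₁, dite_false, dite_true, Sum.inl.injEq] at h
      exact Or.inr ⟨rfl, h.symm⟩
    · rw [edgeSpliceMap_of_ne h₁ h₂] at h
      exact absurd h (by simp)

theorem edgeSpliceMap_injective {x₁ x₂ : U} {y₁ y₂ : W} (hx : x₁ ≠ x₂) :
    Function.Injective (edgeSpliceMap x₁ x₂ y₁ y₂) := by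
  intro w w' h
  rcases hw : edgeSpliceMap x₁ x₂ y₁ y₂ w with u | z
  · rcases eq_or_eq_of_edgeSpliceMap hw with h1 | h1 <;>
      rcases eq_or_eq_of_edgeSpliceMap (h ▸ hw) with h2 | h2
    · exact h1.1.trans h2.1.symm
    · exact absurd (h1.2.symm.trans h2.2) hx
    · exact absurd (h2.2.symm.trans h1.2) hx
    · exact h1.1.trans h2.1.symm
  · have key : ∀ w, edgeSpliceMap x₁ x₂ y₁ y₂ w = Sum.inr z → w = z.1 := by
      intro w hw
      by_cases h₁ : w = y₁
      · rw [h₁, edgeSpliceMap_left] at hw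
        exact absurd hw (by simp)
      by_cases h₂ : w = y₂
      · rw [h₂, edgeSpliceMap_right fun h => h₁ (h₂.trans h.symm)] at hw
        exact absurd hw (by simp)
      rw [edgeSpliceMap_of_ne h₁ h₂, Sum.inr.injEq] at hw
      rw [← hw]
    exact (key w hw).trans (key w' (h ▸ hw)).symm

theorem edgeSplice_adj {G : SimpleGraph U} {H : SimpleGraph W} {x₁ x₂ : U} {y₁ y₂ : W}
    (hx : x₁ ≠ x₂) {p q : U ⊕ {w : W // w ≠ y₁ ∧ w ≠ y₂}} :
    (G.edgeSplice x₁ x₂ H y₁ y₂).Adj p q ↔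
      (∃ u u', G.Adj u u' ∧ s(u, u') ≠ s(x₁, x₂) ∧ Sum.inl u = p ∧ Sum.inl u' = q) ∨
      ∃ w w', H.Adj w w' ∧ s(w, w') ≠ s(y₁, y₂) ∧ edgeSpliceMap x₁ x₂ y₁ y₂ w = p ∧
        edgeSpliceMap x₁ x₂ y₁ y₂ w' = q := by
  simp only [edgeSplice, sup_adj, map_adj', deleteEdges_adj, Set.mem_singleton_iff, and_assoc]
  refine or_congr ⟨fun h => h.2, fun h => ⟨?_, h⟩⟩ ⟨fun h => h.2, fun h => ⟨?_, h⟩⟩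
  · rintro rfl
    obtain ⟨u, u', hadj, -, rfl, h⟩ := h
    exact hadj.ne (Sum.inl_injective h).symm
  · rintro rfl
    obtain ⟨w, w', hadj, -, rfl, h⟩ := h
    exact hadj.ne (edgeSpliceMap_injective hx h).symm

/-- A graph which is the union of `T - x₁x₂` and `H - y₁y₂`, glued at the ends of these edges, is
isomorphic to the edge splicing. -/
theorem nonempty_iso_edgeSplice {G : SimpleGraph V} {T : SimpleGraph U} {H : SimpleGraph W}
    {x₁ x₂ : U} {y₁ y₂ : W} (hx : x₁ ≠ x₂) (hy : y₁ ≠ y₂) {φ : U → V} {ψ : W → V}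
    (hφ : Function.Injective φ) (hψ : Function.Injective ψ)
    (h₁ : φ x₁ = ψ y₁) (h₂ : φ x₂ = ψ y₂) (hdisj : ∀ u w, φ u = ψ w → w = y₁ ∨ w = y₂)
    (hsurj : ∀ v, (∃ u, φ u = v) ∨ ∃ w, ψ w = v)
    (hadj : ∀ v v', G.Adj v v' ↔
      (∃ u u', T.Adj u u' ∧ s(u, u') ≠ s(x₁, x₂) ∧ φ u = v ∧ φ u' = v') ∨
      ∃ w w', H.Adj w w' ∧ s(w, w') ≠ s(y₁, y₂) ∧ ψ w = v ∧ ψ w' = v') :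
    Nonempty (G ≃g T.edgeSplice x₁ x₂ H y₁ y₂) := by
  let f : U ⊕ {w : W // w ≠ y₁ ∧ w ≠ y₂} → V := Sum.elim φ fun w => ψ w.1
  have hf : ∀ w, f (edgeSpliceMap x₁ x₂ y₁ y₂ w) = ψ w := by
    intro w
    by_cases hw₁ : w = y₁
    · rw [hw₁, edgeSpliceMap_left, ← h₁]
      rfl
    by_cases hw₂ : w = y₂
    · rw [hw₂, edgeSpliceMap_right hy, ← h₂]
      rfl
    rw [edgeSpliceMap_of_ne hw₁ hw₂]
    rfl
  have hinj : Function.Injective f := by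
    rintro (u | w) (u' | w') h
    · exact congrArg _ (hφ h)
    · exact absurd (hdisj u w'.1 h) (not_or.2 w'.2)
    · exact absurd (hdisj u' w.1 h.symm) (not_or.2 w.2)
    · exact congrArg _ (Subtype.ext (hψ h))
  have hsurj' : Function.Surjective f := by
    intro v
    rcases hsurj v with ⟨u, rfl⟩ | ⟨w, rfl⟩
    · exact ⟨Sum.inl u, rfl⟩
    · exact ⟨_, hf w⟩
  refine ⟨(⟨Equiv.ofBijective f ⟨hinj, hsurj'⟩, ?_⟩ : T.edgeSplice x₁ x₂ H y₁ y₂ ≃g G).symm⟩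
  intro p q
  change G.Adj (f p) (f q) ↔ _
  rw [hadj, edgeSplice_adj hx]
  refine or_congr ⟨?_, ?_⟩ ⟨?_, ?_⟩
  · rintro ⟨u, u', ha, hne, hp, hq⟩
    exact ⟨u, u', ha, hne, hinj hp, hinj hq⟩
  · rintro ⟨u, u', ha, hne, rfl, rfl⟩
    exact ⟨u, u', ha, hne, rfl, rfl⟩
  · rintro ⟨w, w', ha, hne, hp, hq⟩
    exact ⟨w, w', ha, hne, hinj ((hf w).trans hp), hinj ((hf w').trans hq)⟩
  · rintro ⟨w, w', ha, hne, rfl, rfl⟩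
    exact ⟨w, w', ha, hne, (hf w).symm, (hf w').symm⟩

end

section QuadChain

theorem ncard_pair_le {α : Type*} (a b : α) : ({a, b} : Set α).ncard ≤ 2 := by
  have := Set.ncard_insert_le a {b}
  rwa [Set.ncard_singleton] at this

theorem quadChain_adj {n : ℕ} {c d : Fin (n + 1) × Fin 2} :
    (quadChain n).Adj c d ↔
      ((c.1.1 + 1 = d.1.1 ∨ d.1.1 + 1 = c.1.1) ∧ c.2 = d.2) ∨ (c.1 = d.1 ∧ c.2 ≠ d.2) := by
  rw [quadChain, boxProd_adj, pathGraph_adj, pathGraph_adj]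
  refine or_congr Iff.rfl ⟨fun h => ⟨h.2, ?_⟩, fun h => ⟨?_, h.1⟩⟩
  · intro he
    have := h.1
    rw [he] at this
    omega
  · have := h.2
    omega

theorem Is22Edge.symm {V : Type*} {G : SimpleGraph V} {x y : V} (h : G.Is22Edge x y) :
    G.Is22Edge y x :=
  ⟨h.1.symm, h.2.2, h.2.1⟩

theorem Is22Edge.exists_other {V : Type*} {G : SimpleGraph V} {x y : V} (h : G.Is22Edge x y) :
    ∃ z, ∀ w, G.Adj x w → w = y ∨ w = z := by
  obtain ⟨a, b, hab, he⟩ := Set.ncard_eq_two.1 h.2.1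
  have hw : ∀ w, G.Adj x w → w = a ∨ w = b := by
    intro w hw
    have : w ∈ ({a, b} : Set V) := he ▸ hw
    simpa using this
  rcases hw y h.1 with rfl | rfl
  · exact ⟨b, hw⟩
  · exact ⟨a, fun w hw' => (hw w hw').symm⟩

/-- A vertex of degree 2 of the chain is on one of the two outermost rungs. -/
theorem quadChain_fst_of_ncard {n : ℕ} {c : Fin (n + 1) × Fin 2}
    (h : ((quadChain n).neighborSet c).ncard = 2) : c.1.1 = 0 ∨ c.1.1 = n := by
  by_contra! hne
  obtain ⟨⟨i, hi⟩, j⟩ := c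
  simp only at hne
  have hsub : ({(⟨i - 1, by omega⟩, j), (⟨i + 1, by omega⟩, j), (⟨i, hi⟩, 1 - j)} :
      Set (Fin (n + 1) × Fin 2)) ⊆ (quadChain n).neighborSet (⟨i, hi⟩, j) := by
    rintro d (rfl | rfl | rfl) <;> rw [mem_neighborSet, quadChain_adj]
    · exact Or.inl ⟨Or.inr (by simp only; omega), rfl⟩
    · exact Or.inl ⟨Or.inl rfl, rfl⟩
    · refine Or.inr ⟨rfl, ?_⟩
      simp only
      omega
  have hc := Set.ncard_le_ncard hsub (Set.toFinite _)
  rw [h, Set.ncard_eq_three.2 ⟨_, _, _, ?_, ?_, ?_, rfl⟩] at hc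
  · omega
  · simp only [ne_eq, Prod.mk.injEq, Fin.mk.injEq]
    omega
  · simp only [ne_eq, Prod.mk.injEq, Fin.mk.injEq]
    omega
  · simp only [ne_eq, Prod.mk.injEq, Fin.mk.injEq]
    omega

theorem Is22Edge.fst_eq {n : ℕ} (hn : 2 ≤ n) {c d : Fin (n + 1) × Fin 2}
    (h : (quadChain n).Is22Edge c d) :
    c.1 = d.1 ∧ c.2 ≠ d.2 ∧ (c.1.1 = 0 ∨ c.1.1 = n) := by
  have h1 := quadChain_fst_of_ncard h.2.1
  have h2 := quadChain_fst_of_ncard h.2.2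
  rcases quadChain_adj.1 h.1 with h3 | h3
  · omega
  · exact ⟨h3.1, h3.2, h1⟩

theorem is22Edge_rung {n : ℕ} (hn : 1 ≤ n) {i : Fin (n + 1)} (hi : i.1 = 0 ∨ i.1 = n) :
    (quadChain n).Is22Edge (i, 0) (i, 1) := by
  have key : ∀ j : Fin 2, ((quadChain n).neighborSet (i, j)).ncard = 2 := by
    intro j
    rw [Set.ncard_eq_two]
    rcases hi with hi | hi
    · refine ⟨(i, 1 - j), (⟨1, by omega⟩, j), ?_, ?_⟩
      · simp only [ne_eq, Prod.mk.injEq, Fin.ext_iff]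
        omega
      · ext ⟨d, j'⟩
        simp only [mem_neighborSet, quadChain_adj, Set.mem_insert_iff, Set.mem_singleton_iff,
          Prod.mk.injEq, Fin.ext_iff]
        omega
    · refine ⟨(i, 1 - j), (⟨n - 1, by omega⟩, j), ?_, ?_⟩
      · simp only [ne_eq, Prod.mk.injEq, Fin.ext_iff]
        omega
      · ext ⟨d, j'⟩
        have := d.2
        simp only [mem_neighborSet, quadChain_adj, Set.mem_insert_iff, Set.mem_singleton_iff,
          Prod.mk.injEq, Fin.ext_iff]
        omega
  exact ⟨quadChain_adj.2 (Or.inr ⟨rfl, by simp⟩), key 0, key 1⟩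

/-- The distance of the rungs of the chain from one of its ends. -/
structure IsLevel (n : ℕ) (p₁ p₂ q₁ q₂ : Fin (n + 1) × Fin 2) (ℓ : Fin (n + 1) × Fin 2 → ℕ) :
    Prop where
  zero : ∀ c, ℓ c = 0 ↔ c = q₁ ∨ c = q₂
  last : ∀ c, ℓ c = n ↔ c = p₁ ∨ c = p₂
  le : ∀ c, ℓ c ≤ n
  card : ∀ i, {c | ℓ c = i}.ncard ≤ 2
  cross : ∀ i < n, ∃ c₁ d₁ c₂ d₂, ∀ c d, (quadChain n).Adj c d → ℓ c ≤ i → i < ℓ d →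
    (c = c₁ ∧ d = d₁) ∨ (c = c₂ ∧ d = d₂)

theorem exists_isLevel {n : ℕ} (hn : 1 ≤ n) {p₁ p₂ q₁ q₂ : Fin (n + 1) × Fin 2}
    (hp : (quadChain n).Is22Edge p₁ p₂) (hq : (quadChain n).Is22Edge q₁ q₂)
    (hpq : Disjoint ({p₁, p₂} : Set (Fin (n + 1) × Fin 2)) {q₁, q₂}) :
    ∃ ℓ, IsLevel n p₁ p₂ q₁ q₂ ℓ := by
  classical
  have hd : ∀ c, c = p₁ ∨ c = p₂ → ¬ (c = q₁ ∨ c = q₂) := fun c h1 h2 =>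
    Set.disjoint_left.1 hpq h1 h2
  rcases Nat.lt_or_ge n 2 with hn2 | hn2
  · obtain rfl : n = 1 := by omega
    have hall : ∀ c, (c = q₁ ∨ c = q₂) ∨ (c = p₁ ∨ c = p₂) := by
      have hu : ({p₁, p₂} ∪ {q₁, q₂} : Finset (Fin 2 × Fin 2)) = univ := by
        apply eq_univ_of_card
        rw [card_union_of_disjoint, card_pair hp.1.ne, card_pair hq.1.ne]
        · rfl
        · rw [Finset.disjoint_left]
          intro c h1 h2
          exact hd c (by simpa using h1) (by simpa using h2)
      intro c
      have := mem_univ c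
      rw [← hu] at this
      simp only [mem_union, mem_insert, mem_singleton] at this
      exact this.symm
    refine ⟨fun c => if c = q₁ ∨ c = q₂ then 0 else 1, fun c => ?_, fun c => ?_, fun c => ?_, ?_, ?_⟩
    · by_cases h : c = q₁ ∨ c = q₂ <;> simp [h]
    · by_cases h : c = q₁ ∨ c = q₂
      · simp only [h, if_true]
        exact ⟨fun h' => absurd h' (by simp), fun h' => absurd h (hd c h')⟩
      · simp only [h, if_false, true_iff]
        exact (hall c).resolve_left h
    · by_cases h : c = q₁ ∨ c = q₂ <;> simp [h]
    · intro i
      have hle : ∀ a b : Fin 2 × Fin 2, ({a, b} : Set (Fin 2 × Fin 2)).ncard ≤ 2 := fun a b =>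
        ncard_pair_le a b
      by_cases hi : i = 0
      · refine (Set.ncard_le_ncard (fun c hc => ?_) (Set.toFinite _)).trans (hle q₁ q₂)
        by_contra h
        have h' : ¬ (c = q₁ ∨ c = q₂) := h
        simp only [Set.mem_ofPred_eq, h', if_false] at hc
        omega
      · refine (Set.ncard_le_ncard (fun c hc => ?_) (Set.toFinite _)).trans (hle p₁ p₂)
        refine (hall c).resolve_left fun h' => ?_
        simp only [Set.mem_ofPred_eq, h', if_true] at hc
        omega
    · intro i hi
      obtain ⟨d₁, h₁⟩ := hq.exists_other
      obtain ⟨d₂, h₂⟩ := hq.symm.exists_other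
      refine ⟨q₁, d₁, q₂, d₂, fun c d hcd hc hd' => ?_⟩
      have hd'' : ¬ (d = q₁ ∨ d = q₂) := by
        intro h
        simp only [h, if_true] at hd'
        omega
      by_cases h : c = q₁ ∨ c = q₂
      · rcases h with rfl | rfl
        · exact Or.inl ⟨rfl, (h₁ d hcd).resolve_left fun h => hd'' (Or.inr h)⟩
        · exact Or.inr ⟨rfl, (h₂ d hcd).resolve_left fun h => hd'' (Or.inl h)⟩
      · simp only [h, if_false] at hc
        omega
  · obtain ⟨p12, pne, pend⟩ := hp.fst_eq hn2
    obtain ⟨q12, qne, qend⟩ := hq.fst_eq hn2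
    have hpe : ∀ c : Fin (n + 1) × Fin 2, c.1.1 = p₁.1.1 ↔ c = p₁ ∨ c = p₂ := by
      intro c
      simp only [Prod.ext_iff, ← p12, Fin.ext_iff]
      omega
    have hqe : ∀ c : Fin (n + 1) × Fin 2, c.1.1 = q₁.1.1 ↔ c = q₁ ∨ c = q₂ := by
      intro c
      simp only [Prod.ext_iff, ← q12, Fin.ext_iff]
      omega
    have hne : p₁.1.1 ≠ q₁.1.1 := fun h => hd p₁ (Or.inl rfl) ((hqe p₁).1 h)
    have hcard : ∀ i : Fin (n + 1), {c : Fin (n + 1) × Fin 2 | c.1 = i}.ncard ≤ 2 := by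
      intro i
      refine (Set.ncard_le_ncard (t := {(i, 0), (i, 1)}) (fun c hc => ?_)
        (Set.toFinite _)).trans (ncard_pair_le _ _)
      simp only [Set.mem_ofPred_eq] at hc
      simp only [Set.mem_insert_iff, Set.mem_singleton_iff, Prod.ext_iff, hc, true_and]
      omega
    rcases qend with qend | qend
    · have pend' : p₁.1.1 = n := by omega
      refine ⟨fun c => c.1.1, fun c => by rw [← hqe, qend], fun c => by rw [← hpe, pend'],
        fun c => by omega, fun i => ?_, fun i hi => ?_⟩
      · by_cases hi : i < n + 1
        · convert hcard ⟨i, hi⟩ using 2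
          ext c
          simp [Fin.ext_iff]
        · rw [(Set.ncard_eq_zero (Set.toFinite _)).2]
          · omega
          · ext c
            simp only [Set.mem_ofPred_eq, Set.mem_empty_iff_false, iff_false]
            omega
      · refine ⟨(⟨i, by omega⟩, 0), (⟨i + 1, by omega⟩, 0), (⟨i, by omega⟩, 1),
          (⟨i + 1, by omega⟩, 1), fun c d hcd hc hd' => ?_⟩
        rw [quadChain_adj] at hcd
        simp only [Prod.ext_iff, Fin.ext_iff] at hcd ⊢
        omega
    · have pend' : p₁.1.1 = 0 := by omega
      refine ⟨fun c => n - c.1.1, fun c => ?_, fun c => ?_,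
        fun c => by omega, fun i => ?_, fun i hi => ?_⟩
      · rw [← hqe]
        omega
      · rw [← hpe]
        omega
      · by_cases hi : i < n + 1
        · convert hcard ⟨n - i, by omega⟩ using 2
          ext c
          simp only [Set.mem_ofPred_eq, Fin.ext_iff]
          omega
        · rw [(Set.ncard_eq_zero (Set.toFinite _)).2]
          · omega
          · ext c
            simp only [Set.mem_ofPred_eq, Set.mem_empty_iff_false, iff_false]
            omega
      · refine ⟨(⟨n - i, by omega⟩, 0), (⟨n - i - 1, by omega⟩, 0), (⟨n - i, by omega⟩, 1),
          (⟨n - i - 1, by omega⟩, 1), fun c d hcd hc hd' => ?_⟩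
        rw [quadChain_adj] at hcd
        simp only [Prod.ext_iff, Fin.ext_iff] at hcd ⊢
        omega

end QuadChain

theorem niceBounded_of_iso_K33 {V : Type*} [Fintype V] {G : SimpleGraph V} {A B : Finset V}
    (hG : G.IsCubicBip A B) (e : G ≃g K33) : G.NiceBounded A B := by
  classical
  have h1 : Fintype.card V = 6 := by
    rw [Fintype.card_congr e.toEquiv]
    rfl
  have h2 := card_le_univ (A ∪ B)
  rw [card_union_of_disjoint hG.disj, hG.card_eq, h1] at h2
  have h3 := hG.card_eq
  intro A' B' _ _ h
  have h4 := card_le_card h.1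
  have h5 := card_le_card h.2.1
  omega

section
variable {U V : Type*} {T : SimpleGraph U} {G : SimpleGraph V} {A B : Finset V} {n : ℕ}
  {t₁ t₂ : U} {p₁ p₂ q₁ q₂ : Fin (n + 1) × Fin 2} {w₁ w₂ : Fin 3 ⊕ Fin 3}

/-- The splicing of a graph with a chain and `K33`. -/
noncomputable abbrev chainSplice (T : SimpleGraph U) (t₁ t₂ : U) (n : ℕ)
    (p₁ p₂ q₁ q₂ : Fin (n + 1) × Fin 2) (w₁ w₂ : Fin 3 ⊕ Fin 3) :=
  T.edgeSplice t₁ t₂ ((quadChain n).edgeSplice p₁ p₂ K33 w₁ w₂) (Sum.inl q₁) (Sum.inl q₂)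

/-- The level of a vertex of the splicing of a graph with a chain and `K33`. -/
def chainLevel {X Y : Type*} {P : X ⊕ Y → Prop} (ℓ : X → ℕ) (n : ℕ) :
    U ⊕ {w : X ⊕ Y // P w} → ℕ :=
  Sum.elim (fun _ => 0) fun w => Sum.elim ℓ (fun _ => n) w.1

theorem chainLevel_edgeSpliceMap {ℓ : Fin (n + 1) × Fin 2 → ℕ} (hℓ : IsLevel n p₁ p₂ q₁ q₂ ℓ)
    (hq : q₁ ≠ q₂)
    (w : (Fin (n + 1) × Fin 2) ⊕ {w : Fin 3 ⊕ Fin 3 // w ≠ w₁ ∧ w ≠ w₂}) :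
    chainLevel ℓ n (edgeSpliceMap t₁ t₂ (Sum.inl q₁) (Sum.inl q₂) w) =
      Sum.elim ℓ (fun _ => n) w := by
  by_cases h₁ : w = Sum.inl q₁
  · rw [h₁, edgeSpliceMap_left]
    exact ((hℓ.zero q₁).2 (Or.inl rfl)).symm
  by_cases h₂ : w = Sum.inl q₂
  · rw [h₂, edgeSpliceMap_right (by simpa using hq)]
    exact ((hℓ.zero q₂).2 (Or.inr rfl)).symm
  rw [edgeSpliceMap_of_ne h₁ h₂]
  rfl

theorem elim_edgeSpliceMap {ℓ : Fin (n + 1) × Fin 2 → ℕ} (hℓ : IsLevel n p₁ p₂ q₁ q₂ ℓ)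
    (hw : w₁ ≠ w₂) (k : Fin 3 ⊕ Fin 3) :
    Sum.elim ℓ (fun _ => n) (edgeSpliceMap p₁ p₂ w₁ w₂ k) = n := by
  by_cases h₁ : k = w₁
  · rw [h₁, edgeSpliceMap_left]
    exact (hℓ.last p₁).2 (Or.inl rfl)
  by_cases h₂ : k = w₂
  · rw [h₂, edgeSpliceMap_right hw]
    exact (hℓ.last p₂).2 (Or.inr rfl)
  rw [edgeSpliceMap_of_ne h₁ h₂]
  rfl

variable [Fintype V]

/-- The vertices up to a given level are separated from the others by a 2-edge cut. -/
theorem exists_isTwoCut_level (hG : G.IsCubicBip A B) (ht : T.Adj t₁ t₂) (hp : p₁ ≠ p₂)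
    (hq : q₁ ≠ q₂) (hw : w₁ ≠ w₂) {ℓ : Fin (n + 1) × Fin 2 → ℕ}
    (hℓ : IsLevel n p₁ p₂ q₁ q₂ ℓ) (e : G ≃g chainSplice T t₁ t₂ n p₁ p₂ q₁ q₂ w₁ w₂)
    {i : ℕ} (hi : i < n) :
    ∃ s t u r, G.IsTwoCut A B {v | chainLevel ℓ n (e v) ≤ i} s t u r ∧
      (∃ c, ℓ c ≤ i ∧ e s = edgeSpliceMap t₁ t₂ (Sum.inl q₁) (Sum.inl q₂) (Sum.inl c)) ∧
      (∃ c, ℓ c ≤ i ∧ e u = edgeSpliceMap t₁ t₂ (Sum.inl q₁) (Sum.inl q₂) (Sum.inl c)) := by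
  set m := edgeSpliceMap (W := (Fin (n + 1) × Fin 2) ⊕ {w : Fin 3 ⊕ Fin 3 // w ≠ w₁ ∧ w ≠ w₂})
    t₁ t₂ (Sum.inl q₁) (Sum.inl q₂) with hm
  have key : ∀ x y, G.Adj x y → chainLevel ℓ n (e x) ≤ i → i < chainLevel ℓ n (e y) →
      ∃ c d, (quadChain n).Adj c d ∧ ℓ c ≤ i ∧ i < ℓ d ∧ e x = m (Sum.inl c) ∧
        e y = m (Sum.inl d) := by
    intro x y hxy hx hy
    rw [← e.map_adj_iff, edgeSplice_adj ht.ne] at hxy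
    rcases hxy with ⟨u, u', -, -, -, h⟩ | ⟨w, w', hadj, -, h, h'⟩
    · rw [← h] at hy
      exact absurd hy (Nat.not_lt_zero _)
    · rw [← h, chainLevel_edgeSpliceMap hℓ hq] at hx
      rw [← h', chainLevel_edgeSpliceMap hℓ hq] at hy
      rw [edgeSplice_adj hp] at hadj
      rcases hadj with ⟨c, d, hcd, -, rfl, rfl⟩ | ⟨k, k', -, -, rfl, -⟩
      · exact ⟨c, d, hcd, hx, hy, h.symm, h'.symm⟩
      · rw [elim_edgeSpliceMap hℓ hw] at hx
        omega
  obtain ⟨c₁, d₁, c₂, d₂, hcross⟩ := hℓ.cross i hi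
  have hne : {v | chainLevel ℓ n (e v) ≤ i}.Nonempty := by
    refine ⟨e.symm (Sum.inl t₁), ?_⟩
    simp only [Set.mem_ofPred_eq, RelIso.apply_symm_apply]
    exact Nat.zero_le i
  have huniv : {v | chainLevel ℓ n (e v) ≤ i} ≠ Set.univ := by
    intro h
    have := h ▸ Set.mem_univ (e.symm (m (Sum.inl p₁)))
    simp only [Set.mem_ofPred_eq, RelIso.apply_symm_apply] at this
    rw [hm, chainLevel_edgeSpliceMap hℓ hq] at this
    have h2 := (hℓ.last p₁).2 (Or.inl rfl)
    simp only [Sum.elim_inl] at this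
    omega
  obtain ⟨s, t, u, r, h⟩ := hG.exists_isTwoCut hne huniv (x₁ := e.symm (m (Sum.inl c₁)))
    (y₁ := e.symm (m (Sum.inl d₁))) (x₂ := e.symm (m (Sum.inl c₂)))
    (y₂ := e.symm (m (Sum.inl d₂))) (by
      intro x hx y hy hxy
      obtain ⟨c, d, hcd, hc, hd, hex, hey⟩ := key x y hxy hx (not_le.1 hy)
      have hx' : x = e.symm (m (Sum.inl c)) := by rw [← hex, RelIso.symm_apply_apply]
      have hy' : y = e.symm (m (Sum.inl d)) := by rw [← hey, RelIso.symm_apply_apply]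
      rcases hcross c d hcd hc hd with ⟨rfl, rfl⟩ | ⟨rfl, rfl⟩
      · exact Or.inl ⟨hx', hy'⟩
      · exact Or.inr ⟨hx', hy'⟩)
  refine ⟨s, t, u, r, h, ?_, ?_⟩
  · obtain ⟨c, d, -, hc, -, hex, -⟩ := key s t h.adj_st h.mem_s (not_le.1 h.mem_t)
    exact ⟨c, hc, hex⟩
  · obtain ⟨c, d, -, hc, -, hex, -⟩ := key u r h.adj_ur h.mem_u (not_le.1 h.mem_r)
    exact ⟨c, hc, hex⟩

theorem exists_isTorso_chainSplice (hG : G.IsCubicBip A B) (ht : T.Adj t₁ t₂) (hn : 1 ≤ n)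
    (hp : p₁ ≠ p₂) (hq : q₁ ≠ q₂) (hw : w₁ ≠ w₂) {ℓ : Fin (n + 1) × Fin 2 → ℕ}
    (hℓ : IsLevel n p₁ p₂ q₁ q₂ ℓ) (e : G ≃g chainSplice T t₁ t₂ n p₁ p₂ q₁ q₂ w₁ w₂) :
    Set.range (fun u => e.symm (Sum.inl u)) = {v | chainLevel ℓ n (e v) ≤ 0} ∧
      ∃ t₁ t₂ x y, IsTorso T G A B (fun u => e.symm (Sum.inl u)) t₁ t₂ x y := by
  have hrange : Set.range (fun u => e.symm (Sum.inl u)) = {v | chainLevel ℓ n (e v) ≤ 0} := by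
    ext v
    simp only [Set.mem_range, Set.mem_ofPred_eq]
    constructor
    · rintro ⟨u, rfl⟩
      rw [RelIso.apply_symm_apply]
      exact le_rfl
    · intro hv
      rcases hev : e v with u | ⟨w, hw₁, hw₂⟩
      · exact ⟨u, by rw [← hev, RelIso.symm_apply_apply]⟩
      · rw [hev] at hv
        rcases w with c | k
        · rcases (hℓ.zero c).1 (Nat.le_zero.1 hv) with rfl | rfl
          · exact absurd rfl hw₁
          · exact absurd rfl hw₂
        · have : n ≤ 0 := hv
          omega
  refine ⟨hrange, ?_⟩
  have hinj : Function.Injective fun u => e.symm (Sum.inl u) :=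
    fun u u' h => Sum.inl_injective (e.symm.injective h)
  have hadj : ∀ u v, G.Adj (e.symm (Sum.inl u)) (e.symm (Sum.inl v)) ↔
      T.Adj u v ∧ s(u, v) ≠ s(t₁, t₂) := by
    intro u v
    rw [e.symm.map_adj_iff, edgeSplice_adj ht.ne]
    constructor
    · rintro (⟨u', v', h, hne, hu, hv⟩ | ⟨w, w', h, hne, hw, hw'⟩)
      · obtain rfl := Sum.inl_injective hu
        obtain rfl := Sum.inl_injective hv
        exact ⟨h, hne⟩
      · exfalso
        rcases eq_or_eq_of_edgeSpliceMap hw with h1 | h1 <;>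
          rcases eq_or_eq_of_edgeSpliceMap hw' with h2 | h2
        · exact h.ne (h1.1.trans h2.1.symm)
        · exact hne (by rw [h1.1, h2.1])
        · exact hne (by rw [h1.1, h2.1, Sym2.eq_swap])
        · exact h.ne (h1.1.trans h2.1.symm)
    · rintro ⟨h, hne⟩
      exact Or.inl ⟨u, v, h, hne, rfl, rfl⟩
  obtain ⟨s, t, u, r, hcut, ⟨c, hc, hs⟩, ⟨d, hd, hu⟩⟩ :=
    exists_isTwoCut_level hG ht hp hq hw hℓ e (i := 0) (by omega)
  rw [← hrange] at hcut
  have hend : ∀ c v, ℓ c ≤ 0 → e v = edgeSpliceMap t₁ t₂ (Sum.inl q₁) (Sum.inl q₂) (Sum.inl c) →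
      v = e.symm (Sum.inl t₁) ∨ v = e.symm (Sum.inl t₂) := by
    intro c v hc hv
    rcases (hℓ.zero c).1 (Nat.le_zero.1 hc) with rfl | rfl
    · rw [edgeSpliceMap_left] at hv
      exact Or.inl (by rw [← hv, RelIso.symm_apply_apply])
    · rw [edgeSpliceMap_right (by simpa using hq)] at hv
      exact Or.inr (by rw [← hv, RelIso.symm_apply_apply])
  have hsu : s ≠ u := by
    rintro rfl
    exact hG.notMem_right hcut.s_mem hcut.u_mem
  rcases hend c s hc hs with rfl | rfl <;> rcases hend d u hd hu with rfl | rfl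
  · exact absurd rfl hsu
  · exact ⟨t₁, t₂, t, r, hinj, ht, hcut, hadj⟩
  · exact ⟨t₂, t₁, t, r, hinj, ht.symm, hcut, fun u v => by
      rw [hadj, Sym2.eq_swap (a := t₂)]⟩
  · exact absurd rfl hsu

theorem niceBounded_chainSplice (hG : G.IsCubicBip A B) (ht : T.Adj t₁ t₂) (hn : 1 ≤ n)
    (hp : p₁ ≠ p₂) (hq : q₁ ≠ q₂) (hw : w₁ ≠ w₂) {ℓ : Fin (n + 1) × Fin 2 → ℕ}
    (hℓ : IsLevel n p₁ p₂ q₁ q₂ ℓ) (e : G ≃g chainSplice T t₁ t₂ n p₁ p₂ q₁ q₂ w₁ w₂)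
    (hT : ∀ [Fintype U] (A B : Finset U), T.IsCubicBip A B → T.NiceBounded A B) :
    G.NiceBounded A B := by
  classical
  intro A' B' hA' hB' hnice
  set L : V → ℕ := fun v => chainLevel ℓ n (e v) with hL
  set m := edgeSpliceMap (W := (Fin (n + 1) × Fin 2) ⊕ {w : Fin 3 ⊕ Fin 3 // w ≠ w₁ ∧ w ≠ w₂})
    t₁ t₂ (Sum.inl q₁) (Sum.inl q₂) with hm
  have hLn : ∀ v, L v ≤ n := by
    intro v
    simp only [hL]
    rcases e v with u | ⟨c | k, hw⟩
    · exact Nat.zero_le n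
    · exact hℓ.le c
    · exact le_rfl
  have hlevel : ∀ a ∈ A', ∀ b ∈ B', L a = L b := by
    intro a ha b hb
    have hiff : ∀ i < n, L a ≤ i ↔ L b ≤ i := by
      intro i hi
      obtain ⟨s, t, u, r, hcut, -⟩ := exists_isTwoCut_level hG ht hp hq hw hℓ e hi
      exact hcut.mem_iff_of_isNicePair hG (hnice.1 ha) (hnice.2.1 hb) (hnice.2.2 a ha b hb)
    have h1 := hLn a
    have h2 := hLn b
    rcases lt_trichotomy (L a) (L b) with h | h | h
    · have := (hiff (L a) (by omega)).1 le_rfl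
      omega
    · exact h
    · have := (hiff (L b) (by omega)).2 le_rfl
      omega
  obtain ⟨a₀, ha₀⟩ := hA'
  obtain ⟨b₀, hb₀⟩ := hB'
  have hlB : ∀ b ∈ B', L b = L a₀ := fun b hb => (hlevel a₀ ha₀ b hb).symm
  have hlA : ∀ a ∈ A', L a = L a₀ := fun a ha => (hlevel a ha b₀ hb₀).trans (hlB b₀ hb₀)
  have hinr : ∀ v, L v ≠ 0 → ∃ w, e v = m w ∧ Sum.elim ℓ (fun _ => n) w = L v := by
    intro v hv
    simp only [hL] at hv ⊢
    rcases hev : e v with u | w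
    · rw [hev] at hv
      exact absurd rfl hv
    · exact ⟨w.1, by rw [hm, edgeSpliceMap_of_ne w.2.1 w.2.2], rfl⟩
  rcases Nat.eq_zero_or_pos (L a₀) with h0 | hpos
  · obtain ⟨hrange, t₁', t₂', x, y, h⟩ := exists_isTorso_chainSplice hG ht hn hp hq hw hℓ e
    have : Finite U := Finite.of_injective _ h.inj
    have : Fintype U := Fintype.ofFinite U
    have hPT := hT _ _ (h.isCubicBip hG)
    have hr : ∀ v, L v = L a₀ → v ∈ Set.range fun u => e.symm (Sum.inl u) := by
      intro v hv
      rw [hrange]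
      exact (hv.trans h0).le
    have hpre : ∀ S : Finset V, (∀ v ∈ S, L v = L a₀) →
        #(S.preimage (fun u => e.symm (Sum.inl u)) h.inj.injOn) = #S := by
      intro S hS
      rw [card_preimage, filter_true_of_mem fun v hv => hr v (hS v hv)]
    have hne : ∀ v, ∀ S : Finset V, v ∈ S → L v = L a₀ →
        (S.preimage (fun u => e.symm (Sum.inl u)) h.inj.injOn).Nonempty := by
      intro v S hv hvL
      obtain ⟨u, rfl⟩ := hr v hvL
      exact ⟨u, mem_preimage.2 hv⟩
    have hmem : ∀ S : Finset V, ∀ u,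
        u ∈ S.preimage (fun u => e.symm (Sum.inl u)) h.inj.injOn → e.symm (Sum.inl u) ∈ S := by
      intro S u hu
      rw [mem_preimage] at hu
      exact hu
    have := hPT _ _ (hne a₀ A' ha₀ rfl) (hne b₀ B' hb₀ (hlB b₀ hb₀))
      ⟨fun a ha => mem_preimage.2 (hnice.1 (hmem A' a ha)),
        fun b hb => mem_preimage.2 (hnice.2.1 (hmem B' b hb)), fun a ha b hb => by
          have ha' := hmem A' a ha
          have hb' := hmem B' b hb
          exact h.isNicePair_of_map hG (hnice.1 ha') (hnice.2.1 hb') (hnice.2.2 _ ha' _ hb')⟩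
    rwa [hpre A' hlA, hpre B' hlB] at this
  rcases lt_or_eq_of_le (hLn a₀) with hlt | heq
  · have hsmall : ∀ S : Finset V, (∀ v ∈ S, L v = L a₀) → #S ≤ 2 := by
      intro S hS
      refine le_trans ?_ (hℓ.card (L a₀))
      have hsub : (S : Set V) ⊆ (fun c => e.symm (m (Sum.inl c))) '' {c | ℓ c = L a₀} := by
        intro v hv
        have hvL := hS v hv
        obtain ⟨w, hw, hw'⟩ := hinr v (by omega)
        rcases w with c | k
        · exact ⟨c, hw'.trans hvL, by simp only [← hw, RelIso.symm_apply_apply]⟩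
        · have : n = L v := hw'
          omega
      rw [← Set.ncard_coe_finset]
      exact (Set.ncard_le_ncard hsub (Set.toFinite _)).trans (Set.ncard_image_le (Set.toFinite _))
    have h1 := hsmall A' hlA
    have h2 := hsmall B' hlB
    omega
  · obtain ⟨s, t, u, r, hcut, -⟩ :=
      exists_isTwoCut_level hG ht hp hq hw hℓ e (i := n - 1) (by omega)
    set W := {v | chainLevel ℓ n (e v) ≤ n - 1}ᶜ with hW
    have hmW : ∀ v, v ∈ W ↔ L v = n := by
      intro v
      have := hLn v
      simp only [hW, Set.mem_compl_iff, Set.mem_ofPred_eq]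
      change ¬ L v ≤ n - 1 ↔ _
      omega
    have hbal : #(A.filter (· ∈ W)) = #(B.filter (· ∈ W)) := hcut.compl.card_eq hG
    have hsub : A.filter (· ∈ W) ∪ B.filter (· ∈ W) ⊆
        univ.image fun k => e.symm (m (edgeSpliceMap p₁ p₂ w₁ w₂ k)) := by
      intro v hv
      have hvL : L v = n := by
        rw [← filter_union] at hv
        exact (hmW v).1 (mem_filter.1 hv).2
      obtain ⟨w, hw', hw''⟩ := hinr v (by omega)
      have hv' : v = e.symm (m w) := by rw [← hw', RelIso.symm_apply_apply]
      refine mem_image.2 ?_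
      rcases w with c | k
      · rcases (hℓ.last c).1 (hw''.trans hvL) with rfl | rfl
        · exact ⟨w₁, mem_univ _, by rw [edgeSpliceMap_left, hv']⟩
        · exact ⟨w₂, mem_univ _, by rw [edgeSpliceMap_right hw, hv']⟩
      · exact ⟨k.1, mem_univ _, by rw [edgeSpliceMap_of_ne k.2.1 k.2.2, hv']⟩
    have h6 := (card_le_card hsub).trans card_image_le
    rw [card_union_of_disjoint (disjoint_filter_filter hG.disj), Finset.card_univ] at h6
    have h7 : Fintype.card (Fin 3 ⊕ Fin 3) = 6 := rfl
    have h8 : #A' ≤ #(A.filter (· ∈ W)) := card_le_card fun a ha =>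
      mem_filter.2 ⟨hnice.1 ha, (hmW a).2 ((hlA a ha).trans heq)⟩
    have h9 : #B' ≤ #(B.filter (· ∈ W)) := card_le_card fun b hb =>
      mem_filter.2 ⟨hnice.2.1 hb, (hmW b).2 ((hlB b hb).trans heq)⟩
    omega

end

theorem InFamilyT.niceBounded {V : Type u} {G : SimpleGraph V} (h : G.InFamilyT) :
    ∀ [Fintype V] (A B : Finset V), G.IsCubicBip A B → G.NiceBounded A B := by
  induction h with
  | base G h =>
    intro _ A B hG
    obtain ⟨e⟩ := h
    exact niceBounded_of_iso_K33 hG e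
  | step T G hT t₁ t₂ ht n hn p₁ p₂ q₁ q₂ hp hq hpq w₁ w₂ hw h ih =>
    intro _ A B hG
    obtain ⟨e⟩ := h
    obtain ⟨ℓ, hℓ⟩ := exists_isLevel hn hp hq hpq
    exact niceBounded_chainSplice hG ht hn hp.1.ne hq.1.ne hw.ne hℓ e ih


section
variable {V : Type*} {G : SimpleGraph V} {A B : Finset V}

/-- The edges of a copy of `K33 - w₁w₂` with vertices `k` and a chain with rungs `c i`, where the
rung `c 0` is not an edge. -/
def ChainRel (m : ℕ) (c : ℕ → Fin 2 → V) (k : Fin 3 ⊕ Fin 3 → V) (w₁ w₂ : Fin 3 ⊕ Fin 3)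
    (v v' : V) : Prop :=
  (∃ w w', K33.Adj w w' ∧ s(w, w') ≠ s(w₁, w₂) ∧ k w = v ∧ k w' = v') ∨
  (∃ i j, i + 1 ≤ m ∧ ((c i j = v ∧ c (i + 1) j = v') ∨ (c i j = v' ∧ c (i + 1) j = v))) ∨
  ∃ i, 0 < i ∧ i ≤ m ∧ ∃ j j', j ≠ j' ∧ c i j = v ∧ c i j' = v'

/-- The graph `G` induces on `W` a copy of `K33 - w₁w₂` with vertices `k` followed by a chain with
rungs `c 0`, ..., `c m`, where the ends of the rung `c 0` are the images of `w₁` and `w₂`. -/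
structure IsChainEnd (G : SimpleGraph V) (W : Set V) (m : ℕ) (c : ℕ → Fin 2 → V)
    (k : Fin 3 ⊕ Fin 3 → V) (w₁ w₂ : Fin 3 ⊕ Fin 3) : Prop where
  k_inj : Function.Injective k
  adj_w : K33.Adj w₁ w₂
  left : c 0 0 = k w₁
  right : c 0 1 = k w₂
  c_inj : ∀ i ≤ m, ∀ i' ≤ m, ∀ j j', c i j = c i' j' → i = i' ∧ j = j'
  disj : ∀ i ≤ m, ∀ j w, c i j = k w → w = w₁ ∨ w = w₂
  mem_iff : ∀ v, v ∈ W ↔ (∃ w, k w = v) ∨ ∃ i ≤ m, ∃ j, c i j = v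
  adj_of : ∀ v v', ChainRel m c k w₁ w₂ v v' → G.Adj v v'
  of_adj : ∀ v ∈ W, ∀ v' ∈ W, G.Adj v v' → ChainRel m c k w₁ w₂ v v'

namespace IsChainEnd
variable {W : Set V} {m : ℕ} {c c' : ℕ → Fin 2 → V} {k : Fin 3 ⊕ Fin 3 → V}
  {w₁ w₂ : Fin 3 ⊕ Fin 3}

theorem _root_.SimpleGraph.ChainRel.congr (hc : ∀ i ≤ m, c i = c' i) {v v' : V}
    (h : ChainRel m c k w₁ w₂ v v') : ChainRel m c' k w₁ w₂ v v' := by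
  rcases h with h | ⟨i, j, hi, h⟩ | ⟨i, hi0, hi, h⟩
  · exact Or.inl h
  · rw [hc i (by omega), hc (i + 1) hi] at h
    exact Or.inr (Or.inl ⟨i, j, hi, h⟩)
  · rw [hc i hi] at h
    exact Or.inr (Or.inr ⟨i, hi0, hi, h⟩)

theorem congr (h : IsChainEnd G W m c k w₁ w₂) (hc : ∀ i ≤ m, c i = c' i) :
    IsChainEnd G W m c' k w₁ w₂ where
  k_inj := h.k_inj
  adj_w := h.adj_w
  left := by rw [← hc 0 (Nat.zero_le _), h.left]
  right := by rw [← hc 0 (Nat.zero_le _), h.right]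
  c_inj i hi i' hi' j j' he := by
    rw [← hc i hi, ← hc i' hi'] at he
    exact h.c_inj i hi i' hi' j j' he
  disj i hi j w he := by
    rw [← hc i hi] at he
    exact h.disj i hi j w he
  mem_iff v := by
    rw [h.mem_iff]
    refine or_congr Iff.rfl (exists_congr fun i => and_congr_right fun hi => ?_)
    rw [hc i hi]
  adj_of v v' hr := h.adj_of v v' (hr.congr fun i hi => (hc i hi).symm)
  of_adj v hv v' hv' hadj := (h.of_adj v hv v' hv' hadj).congr hc

theorem c_mem (h : IsChainEnd G W m c k w₁ w₂) {i : ℕ} (hi : i ≤ m) (j : Fin 2) : c i j ∈ W :=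
  (h.mem_iff _).2 (Or.inr ⟨i, hi, j, rfl⟩)

theorem k_mem (h : IsChainEnd G W m c k w₁ w₂) (w : Fin 3 ⊕ Fin 3) : k w ∈ W :=
  (h.mem_iff _).2 (Or.inl ⟨w, rfl⟩)

theorem next_notMem
    (hcut : G.IsTwoCut A B W (c m 0) (c (m + 1) 0) (c m 1) (c (m + 1) 1)) (j : Fin 2) :
    c (m + 1) j ∉ W := by
  obtain rfl | rfl : j = 0 ∨ j = 1 := by omega
  · exact hcut.mem_t
  · exact hcut.mem_r

theorem c_inj_succ (hG : G.IsCubicBip A B) (h : IsChainEnd G W m c k w₁ w₂)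
    (hcut : G.IsTwoCut A B W (c m 0) (c (m + 1) 0) (c m 1) (c (m + 1) 1)) :
    ∀ i ≤ m + 1, ∀ i' ≤ m + 1, ∀ j j', c i j = c i' j' → i = i' ∧ j = j' := by
  intro i hi i' hi' j j' he
  rcases Nat.lt_or_ge m i with hm | hm <;> rcases Nat.lt_or_ge m i' with hm' | hm'
  · obtain rfl : i = m + 1 := by omega
    obtain rfl : i' = m + 1 := by omega
    refine ⟨rfl, ?_⟩
    by_contra hne
    have : (j = 0 ∧ j' = 1) ∨ (j = 1 ∧ j' = 0) := by omega
    rcases this with ⟨rfl, rfl⟩ | ⟨rfl, rfl⟩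
    · exact hG.notMem_right hcut.r_mem (he ▸ hcut.t_mem)
    · exact hG.notMem_right hcut.r_mem (he.symm ▸ hcut.t_mem)
  · obtain rfl : i = m + 1 := by omega
    exact absurd (he ▸ h.c_mem hm' j') (next_notMem hcut j)
  · obtain rfl : i' = m + 1 := by omega
    exact absurd (he ▸ h.c_mem hm j) (next_notMem hcut j')
  · exact h.c_inj i hm i' hm' j j' he

theorem disj_succ (h : IsChainEnd G W m c k w₁ w₂)
    (hcut : G.IsTwoCut A B W (c m 0) (c (m + 1) 0) (c m 1) (c (m + 1) 1)) :
    ∀ i ≤ m + 1, ∀ j w, c i j = k w → w = w₁ ∨ w = w₂ := by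
  intro i hi j w he
  rcases Nat.lt_or_ge m i with hm | hm
  · obtain rfl : i = m + 1 := by omega
    exact absurd (he ▸ h.k_mem w) (next_notMem hcut j)
  · exact h.disj i hm j w he

theorem adj_rail (h : IsChainEnd G W m c k w₁ w₂)
    (hcut : G.IsTwoCut A B W (c m 0) (c (m + 1) 0) (c m 1) (c (m + 1) 1)) {i : ℕ} (hi : i ≤ m)
    (j : Fin 2) : G.Adj (c i j) (c (i + 1) j) := by
  rcases lt_or_eq_of_le hi with hi | rfl
  · exact h.adj_of _ _ (Or.inr (Or.inl ⟨i, j, hi, Or.inl ⟨rfl, rfl⟩⟩))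
  · obtain rfl | rfl : j = 0 ∨ j = 1 := by omega
    · exact hcut.adj_st
    · exact hcut.adj_ur

theorem exists_of_cross
    (hcut : G.IsTwoCut A B W (c m 0) (c (m + 1) 0) (c m 1) (c (m + 1) 1)) {v v' : V}
    (hv : v ∈ W) (hv' : v' ∉ W) (hadj : G.Adj v v') : ∃ j, c m j = v ∧ c (m + 1) j = v' := by
  rcases hcut.cross hv hv' hadj with h | h
  · exact ⟨0, h.1.symm, h.2.symm⟩
  · exact ⟨1, h.1.symm, h.2.symm⟩

theorem _root_.SimpleGraph.ChainRel.succ {v v' : V} (h : ChainRel m c k w₁ w₂ v v') :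
    ChainRel (m + 1) c k w₁ w₂ v v' := by
  rcases h with h | ⟨i, j, hi, h⟩ | ⟨i, hi0, hi, h⟩
  · exact Or.inl h
  · exact Or.inr (Or.inl ⟨i, j, by omega, h⟩)
  · exact Or.inr (Or.inr ⟨i, hi0, by omega, h⟩)

theorem extend (hG : G.IsCubicBip A B) (h : IsChainEnd G W m c k w₁ w₂)
    (hcut : G.IsTwoCut A B W (c m 0) (c (m + 1) 0) (c m 1) (c (m + 1) 1))
    (hadj : G.Adj (c (m + 1) 0) (c (m + 1) 1)) :
    IsChainEnd G (W ∪ {c (m + 1) 0, c (m + 1) 1}) (m + 1) c k w₁ w₂ := by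
  have hnew : ∀ v, v ∈ W ∪ {c (m + 1) 0, c (m + 1) 1} → v ∉ W → ∃ j, c (m + 1) j = v := by
    rintro v (hv | rfl | rfl) hvW
    · exact absurd hv hvW
    · exact ⟨0, rfl⟩
    · exact ⟨1, rfl⟩
  refine ⟨h.k_inj, h.adj_w, h.left, h.right, c_inj_succ hG h hcut, h.disj_succ hcut, ?_, ?_, ?_⟩
  · intro v
    constructor
    · intro hv
      by_cases hvW : v ∈ W
      · rcases (h.mem_iff v).1 hvW with h1 | ⟨i, hi, h1⟩
        · exact Or.inl h1
        · exact Or.inr ⟨i, by omega, h1⟩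
      · obtain ⟨j, hj⟩ := hnew v hv hvW
        exact Or.inr ⟨m + 1, le_rfl, j, hj⟩
    · rintro (⟨w, rfl⟩ | ⟨i, hi, j, rfl⟩)
      · exact Or.inl (h.k_mem w)
      · rcases Nat.lt_or_ge m i with hm | hm
        · obtain rfl : i = m + 1 := by omega
          obtain rfl | rfl : j = 0 ∨ j = 1 := by omega
          · exact Or.inr (Or.inl rfl)
          · exact Or.inr (Or.inr rfl)
        · exact Or.inl (h.c_mem hm j)
  · rintro v v' (h1 | ⟨i, j, hi, ⟨rfl, rfl⟩ | ⟨rfl, rfl⟩⟩ | ⟨i, hi0, hi, j, j', hj, rfl, rfl⟩)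
    · exact h.adj_of v v' (Or.inl h1)
    · exact h.adj_rail hcut (by omega) j
    · exact (h.adj_rail hcut (by omega) j).symm
    · rcases Nat.lt_or_ge m i with hm | hm
      · obtain rfl : i = m + 1 := by omega
        have : (j = 0 ∧ j' = 1) ∨ (j = 1 ∧ j' = 0) := by omega
        rcases this with ⟨rfl, rfl⟩ | ⟨rfl, rfl⟩
        · exact hadj
        · exact hadj.symm
      · exact h.adj_of _ _ (Or.inr (Or.inr ⟨i, hi0, hm, j, j', hj, rfl, rfl⟩))
  · intro v hv v' hv' hvv'
    by_cases hvW : v ∈ W <;> by_cases hvW' : v' ∈ W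
    · exact (h.of_adj v hvW v' hvW' hvv').succ
    · obtain ⟨j, h1⟩ := exists_of_cross hcut hvW hvW' hvv'
      exact Or.inr (Or.inl ⟨m, j, le_rfl, Or.inl h1⟩)
    · obtain ⟨j, h1⟩ := exists_of_cross hcut hvW' hvW hvv'.symm
      exact Or.inr (Or.inl ⟨m, j, le_rfl, Or.inr h1⟩)
    · obtain ⟨j, rfl⟩ := hnew v hv hvW
      obtain ⟨j', rfl⟩ := hnew v' hv' hvW'
      refine Or.inr (Or.inr ⟨m + 1, Nat.succ_pos m, le_rfl, j, j', ?_, rfl, rfl⟩)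
      rintro rfl
      exact hvv'.ne rfl

theorem nonempty_iso (hG : G.IsCubicBip A B) (h : IsChainEnd G W m c k w₁ w₂)
    (hcut : G.IsTwoCut A B W (c m 0) (c (m + 1) 0) (c m 1) (c (m + 1) 1)) {U : Type*}
    {T : SimpleGraph U} {φ : U → V} {t₁ t₂ : U} {x y : V} {A' B' : Finset V}
    (hT : IsTorso T G A' B' φ t₁ t₂ x y) (hφ : Set.range φ = Wᶜ) (ht₁ : φ t₁ = c (m + 1) 0)
    (ht₂ : φ t₂ = c (m + 1) 1) :
    Nonempty (G ≃g T.edgeSplice t₁ t₂ ((quadChain (m + 1)).edgeSplice (0, 0) (0, 1) K33 w₁ w₂)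
      (Sum.inl (Fin.last (m + 1), 0)) (Sum.inl (Fin.last (m + 1), 1))) := by
  let ψ : (Fin (m + 1 + 1) × Fin 2) ⊕ {w : Fin 3 ⊕ Fin 3 // w ≠ w₁ ∧ w ≠ w₂} → V :=
    Sum.elim (fun x => c x.1.1 x.2) fun w => k w.1
  have hp : ((0, 0) : Fin (m + 1 + 1) × Fin 2) ≠ (0, 1) := by simp
  have hψk : ∀ w, ψ (edgeSpliceMap (0, 0) (0, 1) w₁ w₂ w) = k w := by
    intro w
    by_cases hw₁ : w = w₁
    · rw [hw₁, edgeSpliceMap_left]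
      exact h.left
    by_cases hw₂ : w = w₂
    · rw [hw₂, edgeSpliceMap_right h.adj_w.ne]
      exact h.right
    rw [edgeSpliceMap_of_ne hw₁ hw₂]
    rfl
  have hψ : Function.Injective ψ := by
    rintro (⟨i, j⟩ | w) (⟨i', j'⟩ | w') he
    · obtain ⟨h1, h2⟩ := c_inj_succ hG h hcut i.1 (by omega) i'.1 (by omega) j j' he
      rw [Fin.ext h1, h2]
    · exact absurd (h.disj_succ hcut i.1 (by omega) j w'.1 he) (not_or.2 w'.2)
    · exact absurd (h.disj_succ hcut i'.1 (by omega) j' w.1 he.symm) (not_or.2 w.2)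
    · exact congrArg _ (Subtype.ext (h.k_inj he))
  have hout : ∀ z, ψ z ∉ W →
      z = Sum.inl (Fin.last (m + 1), 0) ∨ z = Sum.inl (Fin.last (m + 1), 1) := by
    rintro (⟨i, j⟩ | w) hz
    · have hi : i = Fin.last (m + 1) := by
        by_contra hne
        have : i.1 ≠ m + 1 := fun h' => hne (Fin.ext h')
        exact hz (h.c_mem (i := i.1) (by omega) j)
      subst hi
      obtain rfl | rfl : j = 0 ∨ j = 1 := by omega
      · exact Or.inl rfl
      · exact Or.inr rfl
    · exact absurd (h.k_mem w.1) hz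
  have hφW : ∀ u, φ u ∉ W := by
    intro u
    have : φ u ∈ Set.range φ := ⟨u, rfl⟩
    rwa [hφ] at this
  have hnq : ∀ z z', ψ z ∈ W ∨ ψ z' ∈ W →
      s(z, z') ≠ s(Sum.inl (Fin.last (m + 1), 0), Sum.inl (Fin.last (m + 1), 1)) := by
    intro z z' hz he
    have h0 : ψ (Sum.inl (Fin.last (m + 1), 0)) ∉ W := hcut.mem_t
    have h1 : ψ (Sum.inl (Fin.last (m + 1), 1)) ∉ W := hcut.mem_r
    rcases Sym2.eq_iff.1 he with ⟨rfl, rfl⟩ | ⟨rfl, rfl⟩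
    · exact hz.elim h0 h1
    · exact hz.elim h1 h0
  have hchain : ∀ i j i' j', (quadChain (m + 1)).Adj (i, j) (i', j') → ¬ (i = i' ∧ i.1 = 0) →
      ((quadChain (m + 1)).edgeSplice (0, 0) (0, 1) K33 w₁ w₂).Adj (Sum.inl (i, j))
        (Sum.inl (i', j')) := by
    intro i j i' j' hadj hi
    refine (edgeSplice_adj hp).2 (Or.inl ⟨_, _, hadj, fun he => hi ?_, rfl, rfl⟩)
    rcases Sym2.eq_iff.1 he with h1 | h1 <;> simp only [Prod.mk.injEq] at h1
    · exact ⟨h1.1.1.trans h1.2.1.symm, by rw [h1.1.1]; rfl⟩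
    · exact ⟨h1.1.1.trans h1.2.1.symm, by rw [h1.1.1]; rfl⟩
  have hrail : ∀ i, ∀ hi : i ≤ m, ∀ j,
      ((quadChain (m + 1)).edgeSplice (0, 0) (0, 1) K33 w₁ w₂).Adj
        (Sum.inl (⟨i, by omega⟩, j)) (Sum.inl (⟨i + 1, by omega⟩, j)) := by
    intro i hi j
    refine hchain _ _ _ _ (quadChain_adj.2 (Or.inl ⟨Or.inl rfl, rfl⟩)) ?_
    rintro ⟨h1, -⟩
    have := congrArg Fin.val h1
    simp only at this
    omega
  refine nonempty_iso_edgeSplice hT.adj.ne (by simp) hT.inj hψ ht₁ ht₂ ?_ ?_ ?_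
  · intro u z he
    exact hout z (he ▸ hφW u)
  · intro v
    by_cases hv : v ∈ W
    · right
      rcases (h.mem_iff v).1 hv with ⟨w, rfl⟩ | ⟨i, hi, j, rfl⟩
      · exact ⟨_, hψk w⟩
      · exact ⟨Sum.inl (⟨i, by omega⟩, j), rfl⟩
    · left
      have : v ∈ Set.range φ := by rwa [hφ]
      exact this
  · intro v v'
    constructor
    · intro hadj
      by_cases hv : v ∈ W <;> by_cases hv' : v' ∈ W
      · right
        rcases h.of_adj v hv v' hv' hadj with ⟨w, w', hww, hne, rfl, rfl⟩ |
          ⟨i, j, hi, ⟨rfl, rfl⟩ | ⟨rfl, rfl⟩⟩ | ⟨i, hi0, hi, j, j', hj, rfl, rfl⟩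
        · refine ⟨_, _, (edgeSplice_adj hp).2 (Or.inr ⟨w, w', hww, hne, rfl, rfl⟩),
            hnq _ _ (Or.inl ?_), hψk w, hψk w'⟩
          rwa [hψk]
        · exact ⟨_, _, hrail i (by omega) j, hnq _ _ (Or.inl hv), rfl, rfl⟩
        · exact ⟨_, _, (hrail i (by omega) j).symm, hnq _ _ (Or.inl hv), rfl, rfl⟩
        · refine ⟨Sum.inl (⟨i, by omega⟩, j), Sum.inl (⟨i, by omega⟩, j'),
            hchain _ _ _ _ (quadChain_adj.2 (Or.inr ⟨rfl, hj⟩)) ?_, hnq _ _ (Or.inl hv), rfl, rfl⟩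
          rintro ⟨-, h1⟩
          simp only at h1
          omega
      · obtain ⟨j, rfl, rfl⟩ := exists_of_cross hcut hv hv' hadj
        exact Or.inr ⟨_, _, hrail m le_rfl j, hnq _ _ (Or.inl hv), rfl, rfl⟩
      · obtain ⟨j, rfl, rfl⟩ := exists_of_cross hcut hv' hv hadj.symm
        exact Or.inr ⟨_, _, (hrail m le_rfl j).symm, hnq _ _ (Or.inr hv'), rfl, rfl⟩
      · have h1 : v ∈ Set.range φ := by rwa [hφ]
        have h2 : v' ∈ Set.range φ := by rwa [hφ]
        obtain ⟨u, rfl⟩ := h1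
        obtain ⟨u', rfl⟩ := h2
        obtain ⟨h3, h4⟩ := (hT.adj_iff u u').1 hadj
        exact Or.inl ⟨u, u', h3, h4, rfl, rfl⟩
    · rintro (⟨u, u', h1, h2, rfl, rfl⟩ | ⟨z, z', hadj, hne, rfl, rfl⟩)
      · exact (hT.adj_iff u u').2 ⟨h1, h2⟩
      · rw [edgeSplice_adj hp] at hadj
        rcases hadj with ⟨⟨i, j⟩, ⟨i', j'⟩, h1, h2, rfl, rfl⟩ | ⟨w, w', h1, h2, rfl, rfl⟩
        · change G.Adj (c i.1 j) (c i'.1 j')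
          rcases quadChain_adj.1 h1 with ⟨h3 | h3, h4⟩ | ⟨h3, h4⟩
          · simp only at h3 h4
            rw [← h3, ← h4]
            exact h.adj_rail hcut (by omega) j
          · simp only at h3 h4
            rw [← h3, h4]
            exact (h.adj_rail hcut (by omega) j').symm
          · simp only at h3 h4
            subst h3
            have hj : (j = 0 ∧ j' = 1) ∨ (j = 1 ∧ j' = 0) := by omega
            have hi0 : i.1 ≠ 0 := by
              intro hi
              obtain rfl : i = 0 := Fin.ext hi
              rcases hj with ⟨rfl, rfl⟩ | ⟨rfl, rfl⟩
              · exact h2 rfl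
              · exact h2 Sym2.eq_swap
            have hil : i.1 ≠ m + 1 := by
              intro hi
              obtain rfl : i = Fin.last (m + 1) := Fin.ext hi
              rcases hj with ⟨rfl, rfl⟩ | ⟨rfl, rfl⟩
              · exact hne rfl
              · exact hne Sym2.eq_swap
            exact h.adj_of _ _ (Or.inr (Or.inr
              ⟨i.1, by omega, by omega, j, j', h4, rfl, rfl⟩))
        · rw [hψk, hψk]
          exact h.adj_of _ _ (Or.inl ⟨w, w', h1, h2, rfl, rfl⟩)

/-- The chain can be followed until the ends of the next rung are not adjacent. -/
theorem exists_maximal [Finite V] (N : ℕ) : ∀ (A B : Finset V) (W : Set V) (m : ℕ)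
    (c : ℕ → Fin 2 → V), Wᶜ.ncard ≤ N → G.IsCubicBip A B → IsChainEnd G W m c k w₁ w₂ →
    G.IsTwoCut A B W (c m 0) (c (m + 1) 0) (c m 1) (c (m + 1) 1) →
    ∃ (A' B' : Finset V) (W' : Set V) (m' : ℕ) (c' : ℕ → Fin 2 → V),
      (A' = A ∧ B' = B ∨ A' = B ∧ B' = A) ∧ IsChainEnd G W' m' c' k w₁ w₂ ∧
      G.IsTwoCut A' B' W' (c' m' 0) (c' (m' + 1) 0) (c' m' 1) (c' (m' + 1) 1) ∧
      ¬ G.Adj (c' (m' + 1) 0) (c' (m' + 1) 1) := by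
  induction N with
  | zero =>
    intro A B W m c hN hG h hcut
    rw [Nat.le_zero, Set.ncard_eq_zero (Set.toFinite _)] at hN
    have : c (m + 1) 0 ∈ Wᶜ := hcut.mem_t
    rw [hN] at this
    exact absurd this (Set.notMem_empty _)
  | succ N ih =>
    intro A B W m c hN hG h hcut
    by_cases hadj : G.Adj (c (m + 1) 0) (c (m + 1) 1)
    · obtain ⟨t', r', hcut'⟩ := hcut.extend hG hadj
      have hext := h.extend hG hcut hadj
      let c' := Function.update c (m + 2) ![r', t']
      have hcc : ∀ i ≤ m + 1, c i = c' i := by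
        intro i hi
        have : i ≠ m + 2 := by omega
        simp [c', this]
      have h0 : c' (m + 1 + 1) 0 = r' := by simp [c']
      have h1 : c' (m + 1 + 1) 1 = t' := by simp [c']
      obtain ⟨A', B', W', m', c'', hAB, h1', h2', h3'⟩ := ih B A
        (W ∪ {c (m + 1) 0, c (m + 1) 1}) (m + 1) c' (by
          have : (W ∪ {c (m + 1) 0, c (m + 1) 1})ᶜ.ncard < Wᶜ.ncard := by
            refine Set.ncard_lt_ncard ⟨Set.compl_subset_compl.2 Set.subset_union_left,
              fun hsub => ?_⟩
            have hmem : c (m + 1) 0 ∈ Wᶜ := hcut.mem_t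
            exact hsub hmem (Or.inr (Or.inl rfl))
          omega) hG.symm (hext.congr hcc) (by
          rw [h0, h1, ← hcc (m + 1) le_rfl]
          exact hcut'.swap)
      exact ⟨A', B', W', m', c'', by tauto, h1', h2', h3'⟩
    · exact ⟨A, B, W, m, c, Or.inl ⟨rfl, rfl⟩, h, hcut, hadj⟩

end IsChainEnd

theorem IsTwoCut.isChainEnd (hG : G.IsCubicBip A B) {W : Set V} {s t u r : V}
    (h : G.IsTwoCut A B W s t u r) (hsu : ¬ G.Adj s u) (e : G.torsoGraph W s u ≃g K33)
    {c : ℕ → Fin 2 → V} (hs : c 0 0 = s) (hu : c 0 1 = u) :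
    IsChainEnd G W 0 c (fun z => (e.symm z).1) (e ⟨s, h.mem_s⟩) (e ⟨u, h.mem_u⟩) := by
  have hT := h.isTorso hG hsu
  have hsu' : s ≠ u := by
    rintro rfl
    exact hG.notMem_right h.s_mem h.u_mem
  have hc : ∀ j, c 0 j = s ∨ c 0 j = u := by
    intro j
    obtain rfl | rfl : j = 0 ∨ j = 1 := by omega
    · exact Or.inl hs
    · exact Or.inr hu
  have hes : ∀ v v' : W, s(e v, e v') ≠ s(e ⟨s, h.mem_s⟩, e ⟨u, h.mem_u⟩) ↔
      s(v, v') ≠ s(⟨s, h.mem_s⟩, ⟨u, h.mem_u⟩) := by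
    intro v v'
    rw [ne_eq, ne_eq, Sym2.eq_iff, Sym2.eq_iff]
    simp only [e.injective.eq_iff]
  refine ⟨fun z z' hz => e.symm.injective (Subtype.ext hz), e.map_adj_iff.2 hT.adj, ?_, ?_, ?_,
    ?_, ?_, ?_, ?_⟩
  · simp only [RelIso.symm_apply_apply, hs]
  · simp only [RelIso.symm_apply_apply, hu]
  · intro i hi i' hi' j j' he
    obtain rfl := Nat.le_zero.1 hi
    obtain rfl := Nat.le_zero.1 hi'
    refine ⟨rfl, ?_⟩
    by_contra hne
    have : (j = 0 ∧ j' = 1) ∨ (j = 1 ∧ j' = 0) := by omega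
    rcases this with ⟨rfl, rfl⟩ | ⟨rfl, rfl⟩
    · exact hsu' (hs.symm.trans (he.trans hu))
    · exact hsu' (hs.symm.trans (he.symm.trans hu))
  · intro i hi j w he
    obtain rfl := Nat.le_zero.1 hi
    rcases hc j with h1 | h1
    · left
      rw [← e.apply_symm_apply w]
      exact congrArg _ (Subtype.ext (he.symm.trans h1))
    · right
      rw [← e.apply_symm_apply w]
      exact congrArg _ (Subtype.ext (he.symm.trans h1))
  · intro v
    constructor
    · intro hv
      exact Or.inl ⟨e ⟨v, hv⟩, by simp only [RelIso.symm_apply_apply]⟩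
    · rintro (⟨w, rfl⟩ | ⟨i, hi, j, rfl⟩)
      · exact (e.symm w).2
      · obtain rfl := Nat.le_zero.1 hi
        rcases hc j with h1 | h1 <;> rw [h1]
        · exact h.mem_s
        · exact h.mem_u
  · rintro v v' (⟨w, w', hww, hne, rfl, rfl⟩ | ⟨i, j, hi, -⟩ | ⟨i, hi0, hi, -⟩)
    · refine (hT.adj_iff _ _).2 ⟨e.symm.map_adj_iff.2 hww, (hes _ _).1 ?_⟩
      rwa [e.apply_symm_apply, e.apply_symm_apply]
    · omega
    · omega
  · intro v hv v' hv' hadj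
    obtain ⟨h1, h2⟩ := (hT.adj_iff ⟨v, hv⟩ ⟨v', hv'⟩).1 hadj
    exact Or.inl ⟨e ⟨v, hv⟩, e ⟨v', hv'⟩, e.map_adj_iff.2 h1, (hes _ _).2 h2,
      by simp only [RelIso.symm_apply_apply], by simp only [RelIso.symm_apply_apply]⟩

end

theorem NiceBounded.symm {V : Type*} {G : SimpleGraph V} {A B : Finset V}
    (h : G.NiceBounded A B) : G.NiceBounded B A :=
  fun A' B' hA hB hs => (h B' A' hB hA hs.symm).symm

theorem IsCubicBip.inFamilyT (N : ℕ) : ∀ {V : Type u} [Fintype V] (G : SimpleGraph V)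
    (A B : Finset V), Fintype.card V ≤ N → G.IsCubicBip A B → G.NiceBounded A B →
    G.InFamilyT := by
  classical
  induction N with
  | zero =>
    intro V _ G A B hN hG _
    obtain ⟨v⟩ := hG.conn.nonempty
    exact absurd (Fintype.card_pos_iff.2 ⟨v⟩) (by omega)
  | succ N ih =>
    intro V _ G A B hN hG hP
    by_cases h2 : G.NoTwoCut A B
    · exact .base G (hG.nonempty_iso_K33 h2 hP)
    obtain ⟨W, s, t, u, r, hW, hsu, hmin⟩ := exists_minimal_isTwoCut hG h2
    have hT := hW.isTorso hG hsu
    obtain ⟨e⟩ := (hT.isCubicBip hG).nonempty_iso_K33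
      (hT.noTwoCut hG (by rwa [Subtype.range_coe]) _ _) (hT.niceBounded hG hP)
    let c : ℕ → Fin 2 → V := fun i => if i = 0 then ![s, u] else ![t, r]
    obtain ⟨A', B', W', m, c', hAB, hend, hcut, hnadj⟩ := IsChainEnd.exists_maximal _ A B W 0 c
      le_rfl hG (hW.isChainEnd hG hsu e (c := c) rfl rfl) hW
    obtain ⟨hG', hP'⟩ : G.IsCubicBip A' B' ∧ G.NiceBounded A' B' := by
      rcases hAB with ⟨rfl, rfl⟩ | ⟨rfl, rfl⟩
      · exact ⟨hG, hP⟩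
      · exact ⟨hG.symm, hP.symm⟩
    have hT' := hcut.compl.swap.isTorso hG'.symm hnadj
    have hcard : Fintype.card ↥(W'ᶜ) ≤ N := by
      have : Fintype.card ↥(W'ᶜ) < Fintype.card V :=
        Fintype.card_subtype_lt (x := c' m 0) (fun h => h hcut.mem_s)
      omega
    have hfam := ih _ _ _ hcard (hT'.isCubicBip hG'.symm) (hT'.niceBounded hG'.symm hP'.symm)
    refine .step _ G hfam _ _ hT'.adj (m + 1) (Nat.succ_pos m) (0, 0) (0, 1)
      (Fin.last (m + 1), 0) (Fin.last (m + 1), 1) (is22Edge_rung (Nat.succ_pos m) (Or.inl rfl))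
      (is22Edge_rung (Nat.succ_pos m) (Or.inr rfl)) ?_ _ _ hend.adj_w
      (hend.nonempty_iso hG' hcut hT' Subtype.range_coe rfl rfl)
    rw [Set.disjoint_left]
    rintro x (rfl | rfl) (h | h) <;> simp [Fin.ext_iff] at h

end SimpleGraph

theorem theorem4p1 {V : Type u} [Fintype V] (G : SimpleGraph V) [DecidableRel G.Adj]
    (A B : Finset V) (hconn : G.Connected) (hcubic : G.IsRegularOfDegree 3)
    (hbip : G.IsBipartiteWith (A : Set V) (B : Set V)) :
    (∃ A' B' : Finset V, G.IsNicePairSet A B A' B' ∧ 3 ≤ A'.card ∧ 3 ≤ B'.card) ∧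
    ((∀ A' B' : Finset V, A'.Nonempty → B'.Nonempty → G.IsNicePairSet A B A' B' →
        A'.card ≤ 3 ∧ B'.card ≤ 3) ↔ G.InFamilyT) := by
  have hG : G.IsCubicBip A B := by
    refine ⟨hconn, fun v => ?_, Finset.disjoint_coe.1 hbip.disjoint, fun v w hvw => ?_⟩
    · rw [← hcubic v, ← SimpleGraph.card_neighborFinset_eq_degree, ← Set.ncard_coe_finset,
        SimpleGraph.coe_neighborFinset]
    · exact_mod_cast hbip.mem_of_adj hvw
  exact ⟨hG.exists_isNicePairSet, fun h => SimpleGraph.IsCubicBip.inFamilyT _ G A B le_rfl hG h,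
    fun h => h.niceBounded A B hG⟩
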